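/- Norms are Euclidean. For a system $x_{t+1}=F(x_t,d_t)$ on a normed space with inputs in $\mathbb D$, let $x(t,\xi,d)$ be its solution with $x_0=\xi$ and input sequence $d=(d_0,d_1,\dots)$. The system is \emph{incrementally exponentially stable} (IES) in a set $\mathbb X$ if there are $\kappa>1$, $\lambda>1$ with $\|x(t,\xi_1,d)-x(t,\xi_2,d)\|\le\kappa\|\xi_1-\xi_2\|\lambda^{-t}$ for all $\xi_1,\xi_2\in\mathbb X$, all input sequences $d$ in $\mathbb D$ and all $t\ge 0$. Say that $\xi_1,\xi_2$ \emph{drift apart} under $d$ if for every $M>0$ there is $t'$ with $\|x(t,\xi_1,d)-x(t,\xi_2,d)\|\ge M$ for all $t\ge t'$. The system is \emph{incrementally unstable} (IU) in $\mathbb X$ if for every $\xi_1\in\mathbb X$ and every $d$ there is $\xi_2$ such that $\xi_1,\xi_2$ drift apart under $d$; it is \emph{uniformly locally IU} in $\mathbb X$ if for every $\xi_1\in\mathbb X$ and $r>0$ there is $\xi_2\in\mathbb X$ with $\|\xi_1-\xi_2\|<r$ such that $\xi_1,\xi_2$ drift apart under every $d$. Consider the plant $x_{t+1}=f(x_t,u_t)+w_t$,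 $y_t=h(x_t)+v_t$ with $x_t\in\mathbb R^n$, $u_t\in\mathbb R^m$, $y_t\in\mathbb R^p$, $f$ continuous and $h$ Lipschitz, and the controller $\mathcal X_t=f_c(\mathcal X_{t-1},y^c_t)$, $u_t=h_c(\mathcal X_t,y^c_t)$ with $\mathcal X_t\in\mathbb R^q$ and $f_c,h_c$ measurable. All $w_t\sim N(0,\Sigma_w)$ and $v_t\sim N(0,\Sigma_v)$ are independent, with $\Sigma_w,\Sigma_v$ positive definite. An attack is a sequence of random vectors $a_t\in\mathbb R^p$, $t\ge0$; the controller receives $y^c_t=y_t$ without attack and $y_t^{c,a}=h(x^a_t)+v_t+a_t$ under attack, where the superscript $a$ marks the signals of the attacked loop. Both runs start from the same plant state $x_0$ and controller state $\mathcal X_{-1}=z_0$ and use the same noise. Put $Y_t=(y^c_t,\mathcal X_t)$ and $Y^a_t=(y^{c,a}_t,\mathcal X^a_t)$. The attack is \emph{$\epsilon$-stealthy} if for every $t\ge0$ and every measurable detector $D$ with values in $\{0,1\}$, $\mathbb P(D(Y^a_0,\dots,Y^a_t)=0)+\mathbb P(D(Y_0,\dots,Y_t)=1)\ge 1-\epsilon$.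 It is \emph{$(\epsilon,\alpha)$-successful} if it is $\epsilon$-stealthy and almost surely $\|x^a_{t'}\|\ge\alpha$ for some $t'\ge0$. The system is \emph{$(\epsilon,\alpha)$-attackable} (from $x_0,z_0$) if an $(\epsilon,\alpha)$-successful attack exists. For $s_0\in\mathbb R^n$, the \emph{attack generated by $s_0$} is given by $$s_{t+1}=f(x^a_t,u^a_t)-f(x^a_t-s_t,u^a_t),\qquad a_t=h(x^a_t-s_t)-h(x^a_t).$$ Let $R>0$ and $\mathbf S=\{x\in\mathbb R^n:\|x\|\le R\}$. Suppose that the closed-loop system, with state $(x_t,\mathcal X_{t-1})$ and disturbance $(w_t,v_t)\in\mathbb R^{n+p}$, is IES in $\mathbf S\times\mathbb R^q$, and that the open-loop system $x_{t+1}=f(x_t,u_t)+w_t$, with state $x_t$ and input $(u_t,w_t)\in\mathbb R^{m+n}$, is IU in $\mathbf S$. Then: 1. For all $x_0\in\mathbf S$, $z_0\in\mathbb R^q$, $\epsilon>0$ and $\alpha\in\mathbb R$, the system is $(\epsilon,\alpha)$-attackable. 2. For all $x_0\in\mathbf S$, $z_0\in\mathbb R^q$, $\epsilon>0$ there is $\rho>0$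 such that for every $s_0\neq0$ with $\|s_0\|<\rho$ the attack generated by $s_0$ is $(\epsilon,\alpha)$-successful for all $\alpha$. 3. If the open-loop system is moreover uniformly locally IU in $\mathbf S$, then for all $x_0\in\mathbf S$, $z_0\in\mathbb R^q$, $\epsilon>0$ there is $s_0\ne0$ with $\|s_0\|<\epsilon$ such that the attack generated by $s_0$ is $(\epsilon,\alpha)$-successful for all $\alpha$ and, for every noise realization, $\|x^a_t-x_t\|\to\infty$, where $x_t$ is the state of the run without attack; in particular, for every $\alpha$ there is $t'$ such that, for all $t\ge t'$, $\|x_t\|\le R$ implies $\|x^a_t\|\ge\alpha$. 4. If moreover the maps $f(\cdot,u)$ are Lipschitz on $\mathbf S$ with a constant independent of $u$, then there is a constant $C$ such that for all $x_0\in\mathbf S$, $z_0\in\mathbb R^q$, all $s_0$ with $x_0-s_0\in\mathbf S$ and all $t\ge0$, the attack generated by $s_0$ satisfies $KL\big(\mathrm{law}(Y^a_0,\dots,Y^a_t)\,\|\,\mathrm{law}(Y_0,\dots,Y_t)\big)\le C\|s_0\|^2$. (This part does not use the extra hypothesis of part 3.) -/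

import Mathlib

open MeasureTheory ProbabilityTheory Filter Topology
open scoped NNReal ENNReal

noncomputable section

namespace StealthyAttack

/-- Euclidean space `ℝⁿ` with the 2-norm. -/
abbrev E (n : ℕ) : Type := EuclideanSpace ℝ (Fin n)

/-- The solution at time `t` of `x_{t+1} = F (x_t, d_t)`, `x_0 = ξ`, driven by `d_0, d_1, …`. -/
def traj {X D : Type*} (F : X → D → X) (ξ : X) (d : ℕ → D) : ℕ → X
  | 0 => ξ
  | t + 1 => F (traj F ξ d t) (d t)

/-- Incremental exponential stability in the set `S`; the inputs range over all sequences in `D`. -/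
def IncrExpStable {X D : Type*} [NormedAddCommGroup X] (F : X → D → X) (S : Set X) : Prop :=
  ∃ κ : ℝ, 1 < κ ∧ ∃ lam : ℝ, 1 < lam ∧
    ∀ ξ₁ ∈ S, ∀ ξ₂ ∈ S, ∀ d : ℕ → D, ∀ t : ℕ,
      ‖traj F ξ₁ d t - traj F ξ₂ d t‖ ≤ κ * ‖ξ₁ - ξ₂‖ * lam ^ (-(t : ℤ))

/-- The two solutions from `ξ₁` and `ξ₂` under the same input sequence `d` drift apart:
their distance eventually exceeds every bound for good. -/
def DriftApart {X D : Type*} [NormedAddCommGroup X] (F : X → D → X) (ξ₁ ξ₂ : X)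
    (d : ℕ → D) : Prop :=
  ∀ M : ℝ, 0 < M → ∃ t' : ℕ, ∀ t : ℕ, t' ≤ t → M ≤ ‖traj F ξ₁ d t - traj F ξ₂ d t‖

/-- Incremental instability in the set `S`. -/
def IncrUnstable {X D : Type*} [NormedAddCommGroup X] (F : X → D → X) (S : Set X) : Prop :=
  ∀ ξ₁ ∈ S, ∀ d : ℕ → D, ∃ ξ₂ : X, DriftApart F ξ₁ ξ₂ d

/-- Incremental instability in `S` in which the second initial condition can be taken in `S`,
arbitrarily close to the first one, and the same for all input sequences. -/
def IncrUnstableUnif {X D : Type*} [NormedAddCommGroup X] (F : X → D → X) (S : Set X) : Prop :=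
  ∀ ξ₁ ∈ S, ∀ r : ℝ, 0 < r → ∃ ξ₂ ∈ S, ‖ξ₁ - ξ₂‖ < r ∧ ∀ d : ℕ → D, DriftApart F ξ₁ ξ₂ d

/-- The maps of a plant `x_{t+1} = f (x_t, u_t) + w_t`, `y_t = h (x_t) + v_t` and of a feedback
controller `𝒳_t = f_c (𝒳_{t-1}, y_t)`, `u_t = h_c (𝒳_t, y_t)`. -/
structure FeedbackSystem (n m p q : ℕ) where
  /-- plant dynamics -/
  f : E n → E m → E n
  /-- plant output -/
  h : E n → E p
  /-- controller dynamics -/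
  fc : E q → E p → E q
  /-- controller output -/
  hc : E q → E p → E m

/-- States of the closed loop at time `t`: pairs `(x_t, 𝒳_{t-1})`, with the Euclidean norm. -/
abbrev LoopState (n q : ℕ) : Type := WithLp 2 (E n × E q)

namespace FeedbackSystem

variable {n m p q : ℕ} (sys : FeedbackSystem n m p q)

/-- The input-to-state map `f_u (x, (u, w)) = f (x, u) + w` of the plant. -/
def inputToState (x : E n) (U : E m × E n) : E n := sys.f x U.1 + U.2

/-- Measurement received by the controller, under measurement noise `v` and injection `a`. -/
def received (X : LoopState n q) (v a : E p) : E p := sys.h X.fst + v + a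

/-- Controller state after the received measurement has been processed. -/
def ctrl (X : LoopState n q) (v a : E p) : E q := sys.fc X.snd (sys.received X v a)

/-- Control input computed from the received measurement. -/
def input (X : LoopState n q) (v a : E p) : E m :=
  sys.hc (sys.ctrl X v a) (sys.received X v a)

/-- One step of the closed loop under the noise `(w, v)` and the sensor injection `a`. -/
def attackedLoop (X : LoopState n q) (d : E n × E p × E p) : LoopState n q :=
  WithLp.toLp 2 (sys.f X.fst (sys.input X d.2.1 d.2.2) + d.1, sys.ctrl X d.2.1 d.2.2)

/-- One step of the closed loop without attack, under the disturbance `(w, v)`. -/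
def closedLoop (X : LoopState n q) (W : E n × E p) : LoopState n q :=
  sys.attackedLoop X (W.1, W.2, 0)

variable {Ω : Type*} (w : ℕ → Ω → E n) (v : ℕ → Ω → E p) (x₀ : E n) (z₀ : E q)

/-- State `(x_t, 𝒳_{t-1})` of the closed loop under the attack signal `a`, which starts at time `0`
when the plant is in state `x₀` and the controller in state `z₀`. -/
def state (a : ℕ → Ω → E p) (t : ℕ) (ω : Ω) : LoopState n q :=
  traj sys.attackedLoop (WithLp.toLp 2 (x₀, z₀)) (fun i => (w i ω, v i ω, a i ω)) t

/-- The data `Y_0, …, Y_t` seen by the intrusion detector under the attack `a`, where `Y_i` is the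
received measurement together with the controller state at time `i`. -/
def observed (a : ℕ → Ω → E p) (t : ℕ) (ω : Ω) : Fin (t + 1) → E p × E q := fun i =>
  (sys.received (sys.state w v x₀ z₀ a i ω) (v i ω) (a i ω),
    sys.ctrl (sys.state w v x₀ z₀ a i ω) (v i ω) (a i ω))

variable [MeasurableSpace Ω] (P : Measure Ω)

/-- The sum of the miss-detection probability and of the false-alarm probability at time `t`
of the detector `D` (`true` is an alarm) against the attack `a`. The run without attack is the one
with zero injection. -/
def errorSum (a : ℕ → Ω → E p) (t : ℕ) (D : (Fin (t + 1) → E p × E q) → Bool) : ℝ :=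
  P.real {ω | D (sys.observed w v x₀ z₀ a t ω) = false} +
    P.real {ω | D (sys.observed w v x₀ z₀ (fun _ _ => 0) t ω) = true}

/-- `ε`-stealthiness: at no time does some detector have error sum below `1 - ε`. -/
def IsStealthy (ε : ℝ) (a : ℕ → Ω → E p) : Prop :=
  ∀ t : ℕ, ¬ ∃ D : (Fin (t + 1) → E p × E q) → Bool,
    Measurable D ∧ sys.errorSum w v x₀ z₀ P a t D < 1 - ε

/-- `(ε, α)`-successful attacks: almost surely the plant state reaches norm `α` at some time, and
the attack is `ε`-stealthy. -/
def IsSuccessful (ε α : ℝ) (a : ℕ → Ω → E p) : Prop :=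
  (∀ t, Measurable (a t)) ∧
  (∀ᵐ ω ∂P, ∃ t' : ℕ, α ≤ ‖(sys.state w v x₀ z₀ a t' ω).fst‖) ∧
  sys.IsStealthy w v x₀ z₀ P ε a

/-- `(ε, α)`-attackability: some attack is `(ε, α)`-successful. -/
def IsAttackable (ε α : ℝ) : Prop :=
  ∃ a : ℕ → Ω → E p, sys.IsSuccessful w v x₀ z₀ P ε α a

/-- `a` is the attack with initial value `s₀` generated by
`s_{t+1} = f (xᵃ_t, uᵃ_t) - f (xᵃ_t - s_t, uᵃ_t)`, `a_t = h (xᵃ_t - s_t) - h (xᵃ_t)`,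
where `xᵃ`, `uᵃ` are the plant state and the control input under `a` itself. -/
def IsDriftAttack (s₀ : E n) (a : ℕ → Ω → E p) : Prop :=
  ∃ s : ℕ → Ω → E n, ∀ ω, s 0 ω = s₀ ∧ ∀ t : ℕ,
    s (t + 1) ω =
      sys.f (sys.state w v x₀ z₀ a t ω).fst
          (sys.input (sys.state w v x₀ z₀ a t ω) (v t ω) (a t ω)) -
        sys.f ((sys.state w v x₀ z₀ a t ω).fst - s t ω)
          (sys.input (sys.state w v x₀ z₀ a t ω) (v t ω) (a t ω)) ∧
    a t ω = sys.h ((sys.state w v x₀ z₀ a t ω).fst - s t ω) -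
      sys.h (sys.state w v x₀ z₀ a t ω).fst

end FeedbackSystem

end StealthyAttack

end

open StealthyAttack

/-! The generated attack has an exact description. The controller sees a virtual loop without
attack, started at `x₀ - s₀` and driven by the true noise, while the attacked plant is an open-loop
copy started at `x₀` and driven by the inputs of that virtual loop (`state_driftAttack`,
`observed_driftAttack`). The signal `s_t` is the difference of the two plant states.

Stealthiness thus compares two loops without attack that differ in their initial plant state. By
`nominalData_consSeq_shear`, replacing `x` by `x'` has the same effect on the data as changing only
the noise at time `0`: `v_0` is translated by `h x' - h x`, then `w_0` by a function of the
translated `v_0`. From time `1` on the loops coincide. Both data laws are therefore images, under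
one map, of the sheared and the original noise, so every estimate is uniform in time. Cameron–Martin
gives an explicit density for the shear. Dominated convergence makes the affinity tend to `1` as
`s₀` tends to `0`, which bounds the error sums of all detectors from below. The divergence is
quadratic in the translations and does not increase under the data map.

Large states come from the process noise: whatever the current state, one Gaussian step lands
outside the ball of radius `α` with probability bounded below, so the plant state almost surely
reaches norm `α`. For divergence from the run without attack, incremental instability separates the
copy from the virtual plant, and incremental stability keeps the virtual loop close to the run
started at `x₀`. -/

namespace StealthyAttack

/-! ### Translations of centered Gaussian measures -/

section CameronMartin

open scoped RealInnerProductSpace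

variable {V : Type*} [NormedAddCommGroup V] [InnerProductSpace ℝ V] [FiniteDimensional ℝ V]
  [MeasurableSpace V] [BorelSpace V] {ν : Measure V} [IsGaussian ν]

lemma map_inner_of_centered (hν : ν[id] = 0) (c : V) :
    ν.map (fun x => ⟪c, x⟫) = gaussianReal 0 (covarianceBilin ν c c).toNNReal := by
  have h := IsGaussian.map_eq_gaussianReal (μ := ν) (innerSL ℝ c)
  have h0 : ν[innerSL ℝ c] = 0 := by
    rw [(innerSL ℝ c).integral_comp_id_comm IsGaussian.integrable_id]
    have : ∫ x, x ∂ν = 0 := hν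
    rw [this, map_zero]
  rw [h0] at h
  rw [covarianceBilin_self IsGaussian.memLp_two_id]
  exact h

lemma integrable_exp_inner (hν : ν[id] = 0) (c : V) :
    Integrable (fun x => Real.exp ⟪c, x⟫) ν := by
  have h := integrable_exp_mul_gaussianReal (μ := 0) (v := (covarianceBilin ν c c).toNNReal) 1
  rw [← map_inner_of_centered hν, integrable_map_measure (by fun_prop) (by fun_prop)] at h
  simpa [Function.comp_def] using h

lemma integral_exp_inner (hν : ν[id] = 0) (c : V) :
    ∫ x, Real.exp ⟪c, x⟫ ∂ν = Real.exp (covarianceBilin ν c c / 2) := by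
  have h := mgf_gaussianReal (map_inner_of_centered hν c) 1
  have h0 : 0 ≤ covarianceBilin ν c c := covarianceBilin_self_nonneg c
  simpa [mgf, h0] using h

/-- Cameron–Martin formula: translating a centered Gaussian measure by the covariance image `δ`
of a vector `b` amounts to an exponential tilt along `b`. -/
lemma map_add_eq_withDensity (hν : ν[id] = 0) {b δ : V}
    (hb : ∀ x, covarianceBilin ν x b = ⟪x, δ⟫) :
    ν.map (fun x => x + δ) =
      ν.withDensity (fun x => ENNReal.ofReal (Real.exp (⟪b, x⟫ - ⟪b, δ⟫ / 2))) := by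
  have hbb : covarianceBilin ν b b = ⟪b, δ⟫ := hb b
  have hexp (x : V) : Real.exp (⟪b, x⟫ - ⟪b, δ⟫ / 2) =
      Real.exp (-(⟪b, δ⟫ / 2)) * Real.exp ⟪b, x⟫ := by rw [← Real.exp_add]; ring_nf
  have hint : Integrable (fun x => Real.exp (⟪b, x⟫ - ⟪b, δ⟫ / 2)) ν := by
    simp_rw [hexp]; exact (integrable_exp_inner hν b).const_mul _
  have hfin : IsFiniteMeasure
      (ν.withDensity (fun x => ENNReal.ofReal (Real.exp (⟪b, x⟫ - ⟪b, δ⟫ / 2)))) :=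
    isFiniteMeasure_withDensity_ofReal hint.2
  have hpm : IsProbabilityMeasure (ν.map (fun x => x + δ)) :=
    Measure.isProbabilityMeasure_map (by fun_prop)
  apply Measure.ext_of_charFun
  ext t
  have hmgf1 (s : ℝ) : mgf (fun x => ⟪t, x⟫) (ν.map (fun x => x + δ)) s =
      Real.exp (s * ⟪t, δ⟫ + s ^ 2 * covarianceBilin ν t t / 2) := by
    rw [mgf, integral_map (by fun_prop) (by fun_prop)]
    have : (fun x => Real.exp (s * ⟪t, x + δ⟫)) =
        fun x => Real.exp (s * ⟪t, δ⟫) * Real.exp ⟪s • t, x⟫ := by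
      ext x; rw [← Real.exp_add, inner_add_right, real_inner_smul_left]; ring_nf
    rw [this, integral_const_mul, integral_exp_inner hν, ← Real.exp_add]
    simp only [map_smul, smul_apply, smul_eq_mul]
    ring_nf
  have hmgf2 (s : ℝ) : mgf (fun x => ⟪t, x⟫)
      (ν.withDensity (fun x => ENNReal.ofReal (Real.exp (⟪b, x⟫ - ⟪b, δ⟫ / 2)))) s =
      Real.exp (s * ⟪t, δ⟫ + s ^ 2 * covarianceBilin ν t t / 2) := by
    rw [mgf, integral_withDensity_eq_integral_toReal_smul (by fun_prop) (by simp)]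
    have : (fun x => (ENNReal.ofReal (Real.exp (⟪b, x⟫ - ⟪b, δ⟫ / 2))).toReal •
        Real.exp (s * ⟪t, x⟫)) =
        fun x => Real.exp (-(⟪b, δ⟫ / 2)) * Real.exp ⟪b + s • t, x⟫ := by
      ext x
      rw [ENNReal.toReal_ofReal (Real.exp_pos _).le, smul_eq_mul, ← Real.exp_add, ← Real.exp_add,
        inner_add_left, real_inner_smul_left]
      ring_nf
    rw [this, integral_const_mul, integral_exp_inner hν, ← Real.exp_add]
    simp only [map_smul, map_add, smul_apply, add_apply,
      smul_eq_mul]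
    rw [hbb, covarianceBilin_comm b t, hb t]
    ring_nf
  -- A non-integrable exponential would have integral `0` by convention, whereas the computed value
  -- is positive.
  have hset : integrableExpSet (fun x => ⟪t, x⟫) (ν.map (fun x => x + δ)) = Set.univ := by
    ext s
    simp only [integrableExpSet, Set.mem_ofPred_eq, Set.mem_univ, iff_true]
    by_contra hcon
    have := hmgf1 s
    rw [mgf, integral_undef hcon] at this
    exact (Real.exp_pos _).ne this
  -- Equality of the real moment generating functions extends analytically to the complex plane; the
  -- value at `I` is the characteristic function.
  have key := eqOn_complexMGF_of_mgf (funext fun s => (hmgf1 s).trans (hmgf2 s).symm)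
    (x := Complex.I) (by simp [hset])
  simpa [complexMGF, charFun_apply, real_inner_comm, mul_comm] using key

end CameronMartin

/-! ### Gaussian vectors with positive definite covariance -/

section MultivariateGaussian

variable {ι : Type*} [Fintype ι] [DecidableEq ι] {S : Matrix ι ι ℝ}

open scoped RealInnerProductSpace

/-- Supplies the tilt direction `b = S⁻¹ δ` for Cameron–Martin; since `S` is invertible, every
translation `δ` is admissible. -/
lemma covarianceBilin_inv_apply (hS : S.PosDef) (x δ : EuclideanSpace ℝ ι) :
    covarianceBilin (multivariateGaussian 0 S) x (Matrix.toEuclideanCLM (𝕜 := ℝ) S⁻¹ δ) =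
      ⟪x, δ⟫ := by
  rw [covarianceBilin_multivariateGaussian hS.posSemidef]
  have h : S.mulVec (Matrix.toEuclideanCLM (𝕜 := ℝ) S⁻¹ δ).ofLp = δ.ofLp := by
    rw [Matrix.ofLp_toEuclideanCLM, Matrix.mulVec_mulVec, Matrix.mul_nonsing_inv _
      ((Matrix.isUnit_iff_isUnit_det _).1 hS.isUnit), Matrix.one_mulVec]
  rw [h, EuclideanSpace.inner_eq_star_dotProduct, dotProduct_comm]
  simp

/-- Logarithm of the density of `N(δ, S)` with respect to `N(0, S)`. -/
noncomputable def shiftLogDensity (S : Matrix ι ι ℝ) (δ x : EuclideanSpace ℝ ι) : ℝ :=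
  ⟪Matrix.toEuclideanCLM (𝕜 := ℝ) S⁻¹ δ, x⟫ - ⟪Matrix.toEuclideanCLM (𝕜 := ℝ) S⁻¹ δ, δ⟫ / 2

lemma tendsto_shiftLogDensity_zero {T : Type*} {l : Filter T} {δ : T → EuclideanSpace ℝ ι}
    (hδ : Tendsto δ l (𝓝 0)) (x : EuclideanSpace ℝ ι) :
    Tendsto (fun s => shiftLogDensity S (δ s) x) l (𝓝 0) := by
  have hc : Continuous fun y => shiftLogDensity S y x := by unfold shiftLogDensity; fun_prop
  have h := (hc.tendsto 0).comp hδ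
  rwa [show shiftLogDensity S 0 x = 0 by simp [shiftLogDensity]] at h

lemma _root_.Measurable.shiftLogDensity {A : Type*} [MeasurableSpace A]
    {f g : A → EuclideanSpace ℝ ι} (hf : Measurable f) (hg : Measurable g) :
    Measurable fun a => shiftLogDensity S (f a) (g a) := by
  unfold StealthyAttack.shiftLogDensity; fun_prop

lemma multivariateGaussian_map_add (hS : S.PosDef) (δ : EuclideanSpace ℝ ι) :
    (multivariateGaussian 0 S).map (fun x => x + δ) =
      (multivariateGaussian 0 S).withDensity
        (fun x => ENNReal.ofReal (Real.exp (shiftLogDensity S δ x))) :=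
  map_add_eq_withDensity (by simp) fun x => covarianceBilin_inv_apply hS x δ

lemma lintegral_comp_add_multivariateGaussian (hS : S.PosDef) (δ : EuclideanSpace ℝ ι)
    {g : EuclideanSpace ℝ ι → ℝ≥0∞} (hg : Measurable g) :
    ∫⁻ x, g (x + δ) ∂multivariateGaussian 0 S =
      ∫⁻ x, ENNReal.ofReal (Real.exp (shiftLogDensity S δ x)) * g x
        ∂multivariateGaussian 0 S := by
  have hm : Measurable (fun x => ENNReal.ofReal (Real.exp (shiftLogDensity S δ x))) := by
    unfold shiftLogDensity; fun_prop
  rw [← lintegral_map hg (by fun_prop), multivariateGaussian_map_add hS,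
    lintegral_withDensity_eq_lintegral_mul _ hm hg]
  rfl

/-- A nondegenerate Gaussian vector leaves every ball with probability bounded below,
uniformly in the centre. -/
lemma exists_bound_multivariateGaussian_ball (hS : S.PosDef) [Nonempty ι] (α : ℝ) :
    ∃ β : ℝ≥0∞, β < 1 ∧ ∀ c : EuclideanSpace ℝ ι,
      multivariateGaussian 0 S {x | ‖c + x‖ < α} ≤ β := by
  obtain ⟨i⟩ := ‹Nonempty ι›
  have hmp := measurePreserving_eval_multivariateGaussian (μ := 0) hS.posSemidef (i := i)
  have hv : (S i i).toNNReal ≠ 0 := by simpa using hS.diag_pos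
  set γ := gaussianReal ((0 : EuclideanSpace ℝ ι) i) (S i i).toNNReal
  have hlt {A : Set ℝ} (hA : MeasurableSet A) (h0 : volume Aᶜ ≠ 0) : γ A < 1 := by
    have h1 : γ Aᶜ ≠ 0 := fun h => h0 (gaussianReal_absolutelyContinuous' _ hv h)
    refine lt_of_le_of_ne prob_le_one fun h => h1 ?_
    rwa [prob_compl_eq_zero_iff hA]
  -- It suffices to look at coordinate `i`. According to the sign of `c i`, the event forces `x i <
  -- α` or `x i > -α`, and neither half-line depends on `c`.
  refine ⟨max (γ (Set.Iio α)) (γ (Set.Ioi (-α))), max_lt ?_ ?_, fun c => ?_⟩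
  · exact hlt measurableSet_Iio (by simp)
  · exact hlt measurableSet_Ioi (by simp)
  · have habs (x : EuclideanSpace ℝ ι) (hx : ‖c + x‖ < α) : |c i + x i| < α :=
      lt_of_le_of_lt (by simpa using PiLp.norm_apply_le (c + x) i) hx
    rcases le_total 0 (c i) with hc | hc
    · refine le_trans ?_ (le_max_left _ _)
      rw [← hmp.measure_preimage measurableSet_Iio.nullMeasurableSet]
      refine measure_mono fun x hx => ?_
      have := abs_lt.1 (habs x hx)
      simp only [Set.mem_preimage, Set.mem_Iio]; linarith
    · refine le_trans ?_ (le_max_right _ _)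
      rw [← hmp.measure_preimage measurableSet_Ioi.nullMeasurableSet]
      refine measure_mono fun x hx => ?_
      have := abs_lt.1 (habs x hx)
      simp only [Set.mem_preimage, Set.mem_Ioi]; linarith

end MultivariateGaussian

/-! ### Testing affinity and Kullback–Leibler divergence -/

section Density

variable {𝓧 : Type*} [MeasurableSpace 𝓧] {ν : Measure 𝓧}

/-- The minimum is at most `ρ` on `A` and at most `1` off `A`. With `A` the set of no alarm, this
bounds the error sum below independently of the detector. -/
lemma lintegral_min_le_withDensity_add_compl {ρ : 𝓧 → ℝ≥0∞} (hρ : Measurable ρ)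
    {A : Set 𝓧} (hA : MeasurableSet A) :
    ∫⁻ x, min 1 (ρ x) ∂ν ≤ ν.withDensity ρ A + ν Aᶜ := by
  have hm : Measurable fun x => min 1 (ρ x) := measurable_const.min hρ
  rw [← lintegral_add_compl _ hA, withDensity_apply _ hA]
  refine add_le_add (lintegral_mono fun x => min_le_right _ _) ?_
  calc ∫⁻ x in Aᶜ, min 1 (ρ x) ∂ν ≤ ∫⁻ _ in Aᶜ, 1 ∂ν := lintegral_mono fun x => min_le_left _ _
    _ = ν Aᶜ := by simp

lemma klDiv_withDensity_exp [IsProbabilityMeasure ν] {ℓ : 𝓧 → ℝ} (hℓ : Measurable ℓ)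
    {μ : Measure 𝓧} [IsProbabilityMeasure μ]
    (hμ : μ = ν.withDensity (fun x => ENNReal.ofReal (Real.exp (ℓ x))))
    (hint : Integrable ℓ μ) :
    InformationTheory.klDiv μ ν = ENNReal.ofReal (∫ x, ℓ x ∂μ) := by
  have hac : μ ≪ ν := hμ ▸ withDensity_absolutelyContinuous _ _
  have hllr : llr μ ν =ᵐ[μ] ℓ := by
    have h := Measure.rnDeriv_withDensity ν (f := fun x => ENNReal.ofReal (Real.exp (ℓ x)))
      (by fun_prop)
    rw [← hμ] at h
    filter_upwards [hac.ae_le h] with x hx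
    rw [llr, hx, ENNReal.toReal_ofReal (Real.exp_pos _).le, Real.log_exp]
  rw [InformationTheory.klDiv_of_ac_of_integrable hac ((integrable_congr hllr).2 hint),
    integral_congr_ae hllr]
  simp

/-- Used to discard the noise after time `0`, a common independent factor of both laws. -/
lemma klDiv_prod_right {𝓨 : Type*} [MeasurableSpace 𝓨] (μ ν : Measure 𝓧) [IsFiniteMeasure μ]
    [IsFiniteMeasure ν] (τ : Measure 𝓨) [IsProbabilityMeasure τ] :
    InformationTheory.klDiv (μ.prod τ) (ν.prod τ) = InformationTheory.klDiv μ ν := by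
  rw [← Measure.compProd_const, ← Measure.compProd_const, InformationTheory.klDiv_compProd_left]

end Density

/-! ### Density, divergence and affinity of the sheared noise -/

section Shear

variable {n p : ℕ} {Sw : Matrix (Fin n) (Fin n) ℝ} {Sv : Matrix (Fin p) (Fin p) ℝ}

/-- Law of the noise pair `(w_t, v_t)`. -/
noncomputable def noiseLaw (Sw : Matrix (Fin n) (Fin n) ℝ) (Sv : Matrix (Fin p) (Fin p) ℝ) :
    Measure (E n × E p) :=
  (multivariateGaussian 0 Sw).prod (multivariateGaussian 0 Sv)

instance : IsProbabilityMeasure (noiseLaw Sw Sv) := by unfold noiseLaw; infer_instance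

/-- Translation of the second noise component by `δ`, followed by a translation of the first one
by a function of the new second one. -/
def shear (δ : E p) (η : E p → E n) (d : E n × E p) : E n × E p :=
  (d.1 + η (d.2 + δ), d.2 + δ)

/-- Logarithm of the density of the law of the sheared noise. -/
noncomputable def shearLogDensity (Sw : Matrix (Fin n) (Fin n) ℝ) (Sv : Matrix (Fin p) (Fin p) ℝ)
    (δ : E p) (η : E p → E n) (d : E n × E p) : ℝ :=
  shiftLogDensity Sv δ d.2 + shiftLogDensity Sw (η d.2) d.1

lemma measurable_shear (δ : E p) {η : E p → E n} (hη : Measurable η) :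
    Measurable (shear δ η) := by
  unfold shear; fun_prop

lemma measurable_shearLogDensity (δ : E p) {η : E p → E n} (hη : Measurable η) :
    Measurable (shearLogDensity Sw Sv δ η) := by
  exact (measurable_const.shiftLogDensity measurable_snd).add
    ((hη.comp measurable_snd).shiftLogDensity measurable_fst)

/-- Density of the image of a product measure under a shear, in terms of the densities of the
translates of the factors. -/
lemma map_shear_prod_eq_withDensity {W V : Type*} [MeasurableSpace W] [MeasurableSpace V]
    [Add W] [Add V] [MeasurableAdd₂ W] [MeasurableAdd₂ V] {μ : Measure W} {ν : Measure V}
    [SFinite μ] [SFinite ν] {δ : V} {η : V → W} (hη : Measurable η)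
    {ρ : V → ℝ≥0∞} {σ : V → W → ℝ≥0∞} (hρ : Measurable ρ)
    (hσ : Measurable fun d : W × V => σ d.2 d.1)
    (hν : ∀ g : V → ℝ≥0∞, Measurable g → ∫⁻ y, g (y + δ) ∂ν = ∫⁻ y, ρ y * g y ∂ν)
    (hμ : ∀ (y : V) (g : W → ℝ≥0∞), Measurable g →
      ∫⁻ x, g (x + η y) ∂μ = ∫⁻ x, σ y x * g x ∂μ) :
    (μ.prod ν).map (fun d => (d.1 + η (d.2 + δ), d.2 + δ)) =
      (μ.prod ν).withDensity (fun d => ρ d.2 * σ d.2 d.1) := by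
  have hT : Measurable fun d : W × V => (d.1 + η (d.2 + δ), d.2 + δ) := by fun_prop
  have hd : Measurable fun d : W × V => ρ d.2 * σ d.2 d.1 := (hρ.comp measurable_snd).mul hσ
  refine Measure.ext_of_lintegral _ fun g hg => ?_
  have hinner : Measurable fun y => ∫⁻ x, σ y x * g (x, y) ∂μ := (hσ.mul hg).lintegral_prod_left'
  rw [lintegral_map hg hT, lintegral_withDensity_eq_lintegral_mul _ hd hg,
    lintegral_prod_symm' (fun d : W × V => g (d.1 + η (d.2 + δ), d.2 + δ)) (hg.comp hT),
    lintegral_prod_symm' _ (hd.mul hg)]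
  -- For fixed `y` the shear translates `x` by a constant, so the inner translation can be removed
  -- first and the translation in `y` afterwards.
  have h1 (y : V) : ∫⁻ x, g (x + η (y + δ), y + δ) ∂μ =
      ∫⁻ x, σ (y + δ) x * g (x, y + δ) ∂μ :=
    hμ (y + δ) (fun x => g (x, y + δ)) (hg.comp measurable_prodMk_right)
  simp only [h1]
  rw [hν (fun y => ∫⁻ x, σ y x * g (x, y) ∂μ) hinner]
  refine lintegral_congr fun y => ?_
  have hy : Measurable fun x => σ y x * g (x, y) := (hσ.mul hg).comp measurable_prodMk_right
  rw [← lintegral_const_mul _ hy]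
  exact lintegral_congr fun x => (mul_assoc _ _ _).symm

lemma noiseLaw_map_shear (hSw : Sw.PosDef) (hSv : Sv.PosDef) (δ : E p) {η : E p → E n}
    (hη : Measurable η) :
    (noiseLaw Sw Sv).map (shear δ η) = (noiseLaw Sw Sv).withDensity
      (fun d => ENNReal.ofReal (Real.exp (shearLogDensity Sw Sv δ η d))) := by
  have h := map_shear_prod_eq_withDensity hη
    (measurable_const.shiftLogDensity measurable_id).exp.ennreal_ofReal
    ((hη.comp measurable_snd).shiftLogDensity measurable_fst).exp.ennreal_ofReal
    (fun _ hg => lintegral_comp_add_multivariateGaussian hSv δ hg)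
    (fun y _ hg => lintegral_comp_add_multivariateGaussian hSw (η y) hg)
  simp only [shearLogDensity, Real.exp_add, ENNReal.ofReal_mul (Real.exp_pos _).le]
  exact h

/-- The divergence averages the log-density over the translated law. Evaluation at `x + δ` turns the
quadratic term positive and leaves a centered linear one. -/
lemma shiftLogDensity_add {ι : Type*} [Fintype ι] [DecidableEq ι] {S : Matrix ι ι ℝ}
    (δ x : EuclideanSpace ℝ ι) :
    shiftLogDensity S δ (x + δ) = inner ℝ (Matrix.toEuclideanCLM (𝕜 := ℝ) S⁻¹ δ) x +
      inner ℝ (Matrix.toEuclideanCLM (𝕜 := ℝ) S⁻¹ δ) δ / 2 := by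
  rw [shiftLogDensity, inner_add_right]; ring

lemma inner_clm_self_le {V : Type*} [NormedAddCommGroup V] [InnerProductSpace ℝ V]
    (B : V →L[ℝ] V) {δ : V} {M : ℝ} (hδ : ‖δ‖ ≤ M) : inner ℝ (B δ) δ ≤ ‖B‖ * M ^ 2 := by
  have hM : 0 ≤ M := (norm_nonneg _).trans hδ
  calc inner ℝ (B δ) δ ≤ ‖B δ‖ * ‖δ‖ := real_inner_le_norm _ _
    _ ≤ (‖B‖ * ‖δ‖) * ‖δ‖ := by gcongr; exact B.le_opNorm _
    _ ≤ (‖B‖ * M) * M := by gcongr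
    _ = _ := by ring

/-- The divergence of the sheared noise from the original noise is at most quadratic in the size of
the translations. -/
lemma klDiv_map_shear_le (hSw : Sw.PosDef) (hSv : Sv.PosDef) {δ : E p} {η : E p → E n}
    (hη : Measurable η) {M N : ℝ} (hδM : ‖δ‖ ≤ M) (hηN : ∀ y, ‖η y‖ ≤ N) :
    InformationTheory.klDiv ((noiseLaw Sw Sv).map (shear δ η)) (noiseLaw Sw Sv) ≤
      ENNReal.ofReal (‖Matrix.toEuclideanCLM (𝕜 := ℝ) Sv⁻¹‖ * M ^ 2 / 2 +
        ‖Matrix.toEuclideanCLM (𝕜 := ℝ) Sw⁻¹‖ * N ^ 2 / 2) := by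
  set Bv := Matrix.toEuclideanCLM (𝕜 := ℝ) Sv⁻¹
  set Bw := Matrix.toEuclideanCLM (𝕜 := ℝ) Sw⁻¹
  have hT := measurable_shear δ hη
  have : IsProbabilityMeasure ((noiseLaw Sw Sv).map (shear δ η)) :=
    Measure.isProbabilityMeasure_map hT.aemeasurable
  have hN : 0 ≤ N := (norm_nonneg _).trans (hηN 0)
  have hcomp (d : E n × E p) : shearLogDensity Sw Sv δ η (shear δ η d) =
      (inner ℝ (Bv δ) d.2 + inner ℝ (Bv δ) δ / 2) +
      (inner ℝ (Bw (η (d.2 + δ))) d.1 + inner ℝ (Bw (η (d.2 + δ))) (η (d.2 + δ)) / 2) := by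
    simp only [shearLogDensity, shear, shiftLogDensity_add]; rfl
  have hηm : Measurable fun d : E n × E p => Bw (η (d.2 + δ)) := by fun_prop
  have hηm' : Measurable fun d : E n × E p => η (d.2 + δ) := by fun_prop
  have i1 : Integrable (fun d : E n × E p => (inner ℝ (Bv δ) d.2 : ℝ)) (noiseLaw Sw Sv) :=
    (Integrable.const_inner (Bv δ) IsGaussian.integrable_id).comp_snd _
  have i3 : Integrable (fun d : E n × E p => (inner ℝ (Bw (η (d.2 + δ))) d.1 : ℝ))
      (noiseLaw Sw Sv) := by
    have hb : Integrable (fun d : E n × E p => ‖Bw‖ * N * ‖d.1‖) (noiseLaw Sw Sv) :=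
      (IsGaussian.integrable_id.norm.comp_fst _).const_mul _
    refine hb.mono' (hηm.inner measurable_fst).aestronglyMeasurable (ae_of_all _ fun d => ?_)
    refine (norm_inner_le_norm _ _).trans ?_
    gcongr
    exact (Bw.le_opNorm _).trans (by gcongr; exact hηN _)
  have i4 : Integrable (fun d : E n × E p =>
      (inner ℝ (Bw (η (d.2 + δ))) (η (d.2 + δ)) : ℝ)) (noiseLaw Sw Sv) := by
    refine Integrable.of_bound (hηm.inner hηm').aestronglyMeasurable (‖Bw‖ * N * N)
      (ae_of_all _ fun d => ?_)
    refine (norm_inner_le_norm _ _).trans ?_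
    gcongr
    · exact (Bw.le_opNorm _).trans (by gcongr; exact hηN _)
    · exact hηN _
  have hint : Integrable (fun d => shearLogDensity Sw Sv δ η (shear δ η d)) (noiseLaw Sw Sv) := by
    simp_rw [hcomp]
    exact (i1.add (integrable_const _)).add (i3.add (i4.div_const 2))
  have z1 : ∫ d, (inner ℝ (Bv δ) d.2 : ℝ) ∂noiseLaw Sw Sv = 0 := by
    rw [noiseLaw, integral_fun_snd (fun y => (inner ℝ (Bv δ) y : ℝ)),
      integral_inner (f := fun x => x) IsGaussian.integrable_id]
    simp
  -- The coefficient depends only on `d.2`, so integrating first over the centered `d.1` gives zero.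
  have z3 : ∫ d, (inner ℝ (Bw (η (d.2 + δ))) d.1 : ℝ) ∂noiseLaw Sw Sv = 0 := by
    rw [noiseLaw, integral_prod_symm _ i3]
    simp only
    simp_rw [integral_inner (μ := multivariateGaussian 0 Sw) (f := fun x => x)
      IsGaussian.integrable_id]
    simp
  have hℓ := measurable_shearLogDensity (Sw := Sw) (Sv := Sv) δ hη
  rw [klDiv_withDensity_exp hℓ (noiseLaw_map_shear hSw hSv δ hη)
    ((integrable_map_measure hℓ.aestronglyMeasurable hT.aemeasurable).2 hint),
    integral_map hT.aemeasurable hℓ.aestronglyMeasurable]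
  refine ENNReal.ofReal_le_ofReal ?_
  have hsum : ∫ d, shearLogDensity Sw Sv δ η (shear δ η d) ∂noiseLaw Sw Sv =
      inner ℝ (Bv δ) δ / 2 +
        ∫ d, inner ℝ (Bw (η (d.2 + δ))) (η (d.2 + δ)) / 2 ∂noiseLaw Sw Sv := by
    simp_rw [hcomp]
    have e1 := integral_add (i1.add (integrable_const (inner ℝ (Bv δ) δ / 2 : ℝ)))
      (i3.add (i4.div_const 2))
    have e2 := integral_add i1 (integrable_const (inner ℝ (Bv δ) δ / 2 : ℝ))
    have e3 := integral_add i3 (i4.div_const 2)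
    simp only [Pi.add_apply] at e1 e2 e3
    rw [e1, e2, e3, z1, z3]
    simp
  rw [hsum]
  gcongr
  · exact inner_clm_self_le Bv hδM
  · calc ∫ d, inner ℝ (Bw (η (d.2 + δ))) (η (d.2 + δ)) / 2 ∂noiseLaw Sw Sv
        ≤ ∫ _, ‖Bw‖ * N ^ 2 / 2 ∂noiseLaw Sw Sv := by
          refine integral_mono (i4.div_const 2) (integrable_const _) fun d => ?_
          have := inner_clm_self_le Bw (hηN (d.2 + δ))
          simp only; linarith
      _ = _ := by simp

/-- Affinity of the sheared and the original noise tends to `1` as the translations vanish. -/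
lemma tendsto_lintegral_min_shearLogDensity {T : Type*} {l : Filter T} [l.IsCountablyGenerated]
    {δ : T → E p} {η : T → E p → E n} (hη : ∀ s, Measurable (η s))
    (hδ0 : Tendsto δ l (𝓝 0)) (hη0 : ∀ y, Tendsto (fun s => η s y) l (𝓝 0)) :
    Tendsto (fun s => ∫⁻ d, min 1 (ENNReal.ofReal
      (Real.exp (shearLogDensity Sw Sv (δ s) (η s) d))) ∂noiseLaw Sw Sv) l (𝓝 1) := by
  have h1 : ∫⁻ _, 1 ∂noiseLaw Sw Sv = 1 := by simp
  rw [show 𝓝 (1 : ℝ≥0∞) = 𝓝 (∫⁻ _, 1 ∂noiseLaw Sw Sv) by rw [h1]]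
  refine tendsto_lintegral_filter_of_dominated_convergence (fun _ => 1)
    (Eventually.of_forall fun s => measurable_const.min
      (measurable_shearLogDensity (δ s) (hη s)).exp.ennreal_ofReal)
    (Eventually.of_forall fun s => ae_of_all _ fun d => min_le_left _ _) (by simp)
    (ae_of_all _ fun d => ?_)
  have hlog : Tendsto (fun s => shearLogDensity Sw Sv (δ s) (η s) d) l (𝓝 0) := by
    simpa [shearLogDensity] using (tendsto_shiftLogDensity_zero (S := Sv) hδ0 d.2).add
      (tendsto_shiftLogDensity_zero (S := Sw) (hη0 d.2) d.1)
  have he := (ENNReal.continuous_ofReal.tendsto _).comp ((Real.continuous_exp.tendsto 0).comp hlog)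
  have := (tendsto_const_nhds (x := (1 : ℝ≥0∞))).min he
  simpa using this

end Shear

/-! ### Trajectories under independent identically distributed inputs -/

section Sequences

variable {X D : Type*}

/-- The sequence with first term `d₀` followed by `d`. -/
def consSeq (d₀ : D) (d : ℕ → D) : ℕ → D
  | 0 => d₀
  | i + 1 => d i

lemma consSeq_head_tail (d : ℕ → D) : consSeq (d 0) (fun i => d (i + 1)) = d := by
  funext i; cases i <;> rfl

lemma traj_succ' (F : X → D → X) (ξ : X) (d : ℕ → D) (t : ℕ) :
    traj F ξ d (t + 1) = traj F (F ξ (d 0)) (fun i => d (i + 1)) t := by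
  induction t with
  | zero => rfl
  | succ t ih => rw [traj, ih]; rfl

variable [MeasurableSpace X] [MeasurableSpace D]

lemma measurable_consSeq : Measurable fun z : D × (ℕ → D) => consSeq z.1 z.2 := by
  refine measurable_pi_lambda _ fun i => ?_
  cases i with
  | zero => exact measurable_fst
  | succ i => exact (measurable_pi_apply i).comp measurable_snd

lemma measurable_traj {F : X → D → X} (hF : Measurable (Function.uncurry F)) (t : ℕ) :
    Measurable fun z : X × (ℕ → D) => traj F z.1 z.2 t := by
  induction t with
  | zero => exact measurable_fst
  | succ t ih => exact hF.comp (ih.prodMk ((measurable_pi_apply t).comp measurable_snd))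

/-- If one step keeps the output in `K` with probability at most `β < 1`, uniformly in the state,
then under independent identically distributed inputs the output leaves `K` almost surely. -/
lemma measure_forall_traj_mem_eq_zero {F : X → D → X} (hF : Measurable (Function.uncurry F))
    {K : Set X} (hK : MeasurableSet K) {μ : Measure D} [IsProbabilityMeasure μ]
    {Q : Measure (ℕ → D)} [IsProbabilityMeasure Q]
    (hQ : Q.map (fun d => (d 0, fun i => d (i + 1))) = μ.prod Q)
    {β : ℝ≥0∞} (hβ : β < 1) (hstep : ∀ ξ, μ {d | F ξ d ∈ K} ≤ β) (ξ : X) :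
    Q {d | ∀ t, traj F ξ d (t + 1) ∈ K} = 0 := by
  have hA (ξ : X) : MeasurableSet {d | ∀ t, traj F ξ d (t + 1) ∈ K} := by
    simp only [Set.ofPred_forall]
    exact MeasurableSet.iInter fun t =>
      ((measurable_traj hF (t + 1)).comp measurable_prodMk_left) hK
  -- The supremum over all initial states makes conditioning on the first input close up: after one
  -- step the same event restarts from a new state, so `B ≤ β * B`, and `B ≤ 1` forces `B = 0`.
  set B := ⨆ ξ, Q {d | ∀ t, traj F ξ d (t + 1) ∈ K} with hB
  have hB1 : B ≤ 1 := iSup_le fun ξ => prob_le_one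
  have hm : Measurable fun d : ℕ → D => (d 0, fun i => d (i + 1)) := by fun_prop
  have hle (ξ : X) : Q {d | ∀ t, traj F ξ d (t + 1) ∈ K} ≤ β * B := by
    set C : Set (D × (ℕ → D)) := {z | F ξ z.1 ∈ K ∧ ∀ t, traj F (F ξ z.1) z.2 (t + 1) ∈ K}
    have hFξ : Measurable (F ξ) := hF.comp measurable_prodMk_left
    have hC1 : MeasurableSet {d | F ξ d ∈ K} := hFξ hK
    have hC : MeasurableSet C := by
      have hC2 : MeasurableSet
          {z : D × (ℕ → D) | ∀ t, traj F (F ξ z.1) z.2 (t + 1) ∈ K} := by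
        simp only [Set.ofPred_forall]
        exact MeasurableSet.iInter fun t => ((measurable_traj hF (t + 1)).comp
          ((hFξ.comp measurable_fst).prodMk measurable_snd)) hK
      exact (measurable_fst hC1).inter hC2
    calc Q {d | ∀ t, traj F ξ d (t + 1) ∈ K}
        ≤ Q ((fun d => (d 0, fun i => d (i + 1))) ⁻¹' C) := by
          refine measure_mono fun d hd => ⟨hd 0, fun t => ?_⟩
          have := hd (t + 1)
          rwa [traj_succ'] at this
      _ = ∫⁻ d, Q (Prod.mk d ⁻¹' C) ∂μ := by
          rw [← Measure.map_apply hm hC, hQ, Measure.prod_apply hC]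
      _ ≤ ∫⁻ d, ({d | F ξ d ∈ K}).indicator (fun _ => B) d ∂μ := by
          refine lintegral_mono fun d => ?_
          by_cases hd : F ξ d ∈ K
          · rw [Set.indicator_of_mem (by exact hd)]
            exact le_trans (measure_mono fun d' hd' => hd'.2)
              (le_iSup (fun ξ => Q {d | ∀ t, traj F ξ d (t + 1) ∈ K}) (F ξ d))
          · have : Prod.mk d ⁻¹' C = ∅ := by
              ext d'; simpa [C] using fun h => absurd h hd
            simp [this]
      _ = B * μ {d | F ξ d ∈ K} := by rw [lintegral_indicator_const hC1]
      _ ≤ β * B := by rw [mul_comm]; gcongr; exact hstep ξ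
  have hBβ : B ≤ β * B := iSup_le hle
  have hB0 : B = 0 := by
    by_contra h0
    have : β * B < 1 * B :=
      (ENNReal.mul_lt_mul_iff_left h0 (ne_top_of_le_ne_top ENNReal.one_ne_top hB1)).2 hβ
    rw [one_mul] at this
    exact absurd hBβ (not_le.2 this)
  exact le_antisymm (hB0 ▸ le_iSup (fun ξ => Q {d | ∀ t, traj F ξ d (t + 1) ∈ K}) ξ) zero_le

/-- The head of a sequence of independent identically distributed variables is independent of the
tail, which is distributed like the whole sequence. -/
lemma map_head_tail {Ω : Type*} [MeasurableSpace Ω] {P : Measure Ω} [IsProbabilityMeasure P]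
    {N : ℕ → Ω → D} (hN : ∀ t, Measurable (N t)) {μ : Measure D} (hμ : ∀ t, P.map (N t) = μ)
    (hind : iIndepFun N P) :
    P.map (fun ω => (N 0 ω, fun i => N (i + 1) ω)) = μ.prod (P.map fun ω i => N i ω) := by
  have htm : Measurable fun ω (i : ℕ) => N (i + 1) ω := by fun_prop
  have hindep : IndepFun (N 0) (fun ω (i : ℕ) => N (i + 1) ω) P := by
    have h := indep_iSup_of_disjoint (fun t => (hN t).comap_le) hind.iIndep
      (S := {0}) (T := Set.Ioi 0) (by simp)
    rw [IndepFun_iff_Indep]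
    refine indep_of_indep_of_le_left (indep_of_indep_of_le_right h ?_) ?_
    · rw [MeasurableSpace.pi, MeasurableSpace.comap_iSup]
      refine iSup_le fun i => ?_
      rw [MeasurableSpace.comap_comp]
      exact le_iSup₂_of_le (i + 1) (Nat.succ_pos i) le_rfl
    · simp
  rw [(indepFun_iff_map_prod_eq_prod_map_map (hN 0).aemeasurable htm.aemeasurable).1 hindep, hμ 0]
  congr 1
  -- The tail and the whole sequence both have the infinite product of copies of `μ` as law.
  rw [(hind.precomp (add_left_injective 1)).map_fun_eq_infinitePi_map fun i => hN (i + 1),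
    hind.map_fun_eq_infinitePi_map hN]
  simp_rw [hμ]

end Sequences

namespace FeedbackSystem

variable {n m p q : ℕ} (sys : FeedbackSystem n m p q)

/-! ### Pathwise identities for the closed loop and its copy -/

section Deterministic

/-- Data received by the controller in the loop without attack, started at `X` and driven by the
noise `d`. -/
def nominalData (X : LoopState n q) (t : ℕ) (d : ℕ → E n × E p) : Fin (t + 1) → E p × E q :=
  fun i => (sys.received (traj sys.closedLoop X d i) (d i).2 0,
    sys.ctrl (traj sys.closedLoop X d i) (d i).2 0)

/-- One step of a loop without attack together with a copy of the plant that is driven by the input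
and the process noise of that loop. -/
def coupledLoop (Z : LoopState n q × E n) (d : E n × E p) : LoopState n q × E n :=
  (sys.closedLoop Z.1 d, sys.f Z.2 (sys.input Z.1 d.2 0) + d.1)

lemma fst_traj_coupledLoop (Z : LoopState n q × E n) (d : ℕ → E n × E p) (t : ℕ) :
    (traj sys.coupledLoop Z d t).1 = traj sys.closedLoop Z.1 d t := by
  induction t with
  | zero => rfl
  | succ t ih => simp only [traj, coupledLoop, ih]

/-- Input sequence of the plant in the loop without attack. -/
def nominalInput (X : LoopState n q) (d : ℕ → E n × E p) (t : ℕ) : E m × E n :=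
  (sys.input (traj sys.closedLoop X d t) (d t).2 0, (d t).1)

/-- Together with `fst_traj_closedLoop`, presents the copy and the plant of the loop as open-loop
solutions under one input sequence, the situation that incremental instability speaks of. -/
lemma snd_traj_coupledLoop (Z : LoopState n q × E n) (d : ℕ → E n × E p) (t : ℕ) :
    (traj sys.coupledLoop Z d t).2 = traj sys.inputToState Z.2 (sys.nominalInput Z.1 d) t := by
  induction t with
  | zero => rfl
  | succ t ih =>
    rw [traj, traj, ← ih]
    simp only [coupledLoop, inputToState, nominalInput, fst_traj_coupledLoop]

lemma fst_traj_closedLoop (X : LoopState n q) (d : ℕ → E n × E p) (t : ℕ) :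
    (traj sys.closedLoop X d t).fst =
      traj sys.inputToState X.fst (sys.nominalInput X d) t := by
  induction t with
  | zero => rfl
  | succ t ih => rw [traj, traj, ← ih]; rfl

/-- The injection cancels the output of the actual plant state `x` and substitutes that of the
virtual state `X.fst`. -/
lemma received_shift (x : E n) (X : LoopState n q) (v : E p) :
    sys.received (WithLp.toLp 2 (x, X.snd)) v (sys.h X.fst - sys.h x) = sys.received X v 0 := by
  simp only [received, WithLp.toLp_fst]; abel

lemma ctrl_shift (x : E n) (X : LoopState n q) (v : E p) :
    sys.ctrl (WithLp.toLp 2 (x, X.snd)) v (sys.h X.fst - sys.h x) = sys.ctrl X v 0 := by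
  simp only [ctrl, received_shift, WithLp.toLp_snd]

lemma input_shift (x : E n) (X : LoopState n q) (v : E p) :
    sys.input (WithLp.toLp 2 (x, X.snd)) v (sys.h X.fst - sys.h x) = sys.input X v 0 := by
  simp only [input, received_shift, ctrl_shift]

/-- Shift of the process noise that compensates, in the first step, for the initial plant state `x'`
in place of `x` when the measurement is `h x + y`. -/
def inputShift (x x' : E n) (z : E q) (y : E p) : E n :=
  sys.f x' (sys.input (WithLp.toLp 2 (x, z)) y 0) - sys.f x (sys.input (WithLp.toLp 2 (x, z)) y 0)

/-- Changing the initial plant state has the same effect on the received data as shearing the noise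
at time `0`. -/
lemma nominalData_consSeq_shear (x x' : E n) (z : E q) (t : ℕ) (d₀ : E n × E p)
    (d : ℕ → E n × E p) :
    sys.nominalData (WithLp.toLp 2 (x', z)) t (consSeq d₀ d) =
      sys.nominalData (WithLp.toLp 2 (x, z)) t
        (consSeq (shear (sys.h x' - sys.h x) (sys.inputShift x x' z) d₀) d) := by
  have hrec : sys.received (WithLp.toLp 2 (x', z)) d₀.2 0 =
      sys.received (WithLp.toLp 2 (x, z)) (d₀.2 + (sys.h x' - sys.h x)) 0 := by
    simp only [received, WithLp.toLp_fst]; abel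
  have hctrl : sys.ctrl (WithLp.toLp 2 (x', z)) d₀.2 0 =
      sys.ctrl (WithLp.toLp 2 (x, z)) (d₀.2 + (sys.h x' - sys.h x)) 0 := by
    simp only [ctrl, hrec, WithLp.toLp_snd]
  have hinput : sys.input (WithLp.toLp 2 (x', z)) d₀.2 0 =
      sys.input (WithLp.toLp 2 (x, z)) (d₀.2 + (sys.h x' - sys.h x)) 0 := by
    simp only [input, hrec, hctrl]
  have hstep : sys.closedLoop (WithLp.toLp 2 (x', z)) d₀ = sys.closedLoop (WithLp.toLp 2 (x, z))
      (shear (sys.h x' - sys.h x) (sys.inputShift x x' z) d₀) := by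
    simp only [closedLoop, attackedLoop, shear, inputShift, hinput, hctrl, WithLp.toLp_fst]
    congr 2
    abel
  funext ⟨i, hi⟩
  cases i with
  -- At time `0` the measurements agree although the plant states differ; after one step the full
  -- loop states agree and the remaining noise is the same.
  | zero => exact Prod.ext hrec hctrl
  | succ i => simp only [nominalData, traj_succ', consSeq, hstep]

end Deterministic

/-! ### Measurability of the loop maps -/

section Measurability

variable {sys} {A : Type*} [MeasurableSpace A] {X : A → LoopState n q} {v : A → E p}

lemma measurable_received (hh : Continuous sys.h) {a : A → E p} (hX : Measurable X)
    (hv : Measurable v) (ha : Measurable a) :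
    Measurable fun ω => sys.received (X ω) (v ω) (a ω) := by
  have h1 : Measurable fun ω => (X ω).fst :=
    measurable_fst.comp ((WithLp.measurable_ofLp 2 _).comp hX)
  exact ((hh.measurable.comp h1).add hv).add ha

lemma measurable_ctrl (hh : Continuous sys.h) (hfc : Measurable (Function.uncurry sys.fc))
    {a : A → E p} (hX : Measurable X) (hv : Measurable v) (ha : Measurable a) :
    Measurable fun ω => sys.ctrl (X ω) (v ω) (a ω) := by
  have h1 : Measurable fun ω => (X ω).snd :=
    measurable_snd.comp ((WithLp.measurable_ofLp 2 _).comp hX)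
  exact hfc.comp (h1.prodMk (measurable_received hh hX hv ha))

lemma measurable_input (hh : Continuous sys.h) (hfc : Measurable (Function.uncurry sys.fc))
    (hhc : Measurable (Function.uncurry sys.hc)) {a : A → E p} (hX : Measurable X)
    (hv : Measurable v) (ha : Measurable a) :
    Measurable fun ω => sys.input (X ω) (v ω) (a ω) :=
  hhc.comp ((measurable_ctrl hh hfc hX hv ha).prodMk (measurable_received hh hX hv ha))

lemma measurable_closedLoop (hf : Continuous (Function.uncurry sys.f))
    (hfc : Measurable (Function.uncurry sys.fc)) (hhc : Measurable (Function.uncurry sys.hc))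
    (hh : Continuous sys.h) : Measurable (Function.uncurry sys.closedLoop) := by
  have h1 : Measurable fun z : LoopState n q × (E n × E p) => z.1.fst :=
    measurable_fst.comp ((WithLp.measurable_ofLp 2 _).comp measurable_fst)
  have hv : Measurable fun z : LoopState n q × (E n × E p) => z.2.2 :=
    measurable_snd.comp measurable_snd
  exact (WithLp.measurable_toLp 2 _).comp
    (((hf.measurable.comp (h1.prodMk (measurable_input hh hfc hhc measurable_fst hv
      measurable_const))).add (measurable_fst.comp measurable_snd)).prodMk
        (measurable_ctrl hh hfc measurable_fst hv measurable_const))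

lemma measurable_coupledLoop (hf : Continuous (Function.uncurry sys.f))
    (hfc : Measurable (Function.uncurry sys.fc)) (hhc : Measurable (Function.uncurry sys.hc))
    (hh : Continuous sys.h) : Measurable (Function.uncurry sys.coupledLoop) := by
  have hX : Measurable fun z : (LoopState n q × E n) × (E n × E p) => z.1.1 :=
    measurable_fst.comp measurable_fst
  have hv : Measurable fun z : (LoopState n q × E n) × (E n × E p) => z.2.2 :=
    measurable_snd.comp measurable_snd
  exact ((measurable_closedLoop hf hfc hhc hh).comp (hX.prodMk measurable_snd)).prodMk
    ((hf.measurable.comp ((measurable_snd.comp measurable_fst).prodMk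
      (measurable_input hh hfc hhc hX hv measurable_const))).add
        (measurable_fst.comp measurable_snd))

lemma measurable_nominalData (hf : Continuous (Function.uncurry sys.f))
    (hfc : Measurable (Function.uncurry sys.fc)) (hhc : Measurable (Function.uncurry sys.hc))
    (hh : Continuous sys.h) (X : LoopState n q) (t : ℕ) : Measurable (sys.nominalData X t) := by
  refine measurable_pi_lambda _ fun i => ?_
  have hX : Measurable fun d : ℕ → E n × E p => traj sys.closedLoop X d i :=
    (measurable_traj (measurable_closedLoop hf hfc hhc hh) i).comp measurable_prodMk_left
  have hv : Measurable fun d : ℕ → E n × E p => (d i).2 := by fun_prop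
  exact (measurable_received hh hX hv measurable_const).prodMk
    (measurable_ctrl hh hfc hX hv measurable_const)

lemma measurable_inputShift (hf : Continuous (Function.uncurry sys.f))
    (hfc : Measurable (Function.uncurry sys.fc)) (hhc : Measurable (Function.uncurry sys.hc))
    (hh : Continuous sys.h) (x x' : E n) (z : E q) : Measurable (sys.inputShift x x' z) := by
  have hu : Measurable fun y => sys.input (WithLp.toLp 2 (x, z)) y 0 :=
    measurable_input hh hfc hhc measurable_const measurable_id measurable_const
  exact (hf.measurable.comp (measurable_const.prodMk hu)).sub
    (hf.measurable.comp (measurable_const.prodMk hu))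

end Measurability

/-! ### Explicit form and uniqueness of the generated attack -/

section Attack

variable {Ω : Type*} (w : ℕ → Ω → E n) (v : ℕ → Ω → E p) (x₀ : E n) (z₀ : E q)

/-- The noise realization as a sequence of pairs. -/
def noise (ω : Ω) : ℕ → E n × E p := fun i => (w i ω, v i ω)

lemma state_zero (t : ℕ) (ω : Ω) : sys.state w v x₀ z₀ (fun _ _ => 0) t ω =
    traj sys.closedLoop (WithLp.toLp 2 (x₀, z₀)) (noise w v ω) t := by
  unfold state
  induction t with
  | zero => rfl
  | succ t ih => rw [traj, traj, ih]; rfl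

lemma observed_zero (t : ℕ) (ω : Ω) : sys.observed w v x₀ z₀ (fun _ _ => 0) t ω =
    sys.nominalData (WithLp.toLp 2 (x₀, z₀)) t (noise w v ω) := by
  funext i
  simp only [observed, nominalData, state_zero]
  rfl

/-- The attack that makes the controller see the loop without attack started at `x₀ - s₀`. -/
def driftAttack (s₀ : E n) (t : ℕ) (ω : Ω) : E p :=
  sys.h (traj sys.closedLoop (WithLp.toLp 2 (x₀ - s₀, z₀)) (noise w v ω) t).fst -
    sys.h (traj sys.coupledLoop (WithLp.toLp 2 (x₀ - s₀, z₀), x₀) (noise w v ω) t).2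

lemma state_driftAttack (s₀ : E n) (t : ℕ) (ω : Ω) :
    sys.state w v x₀ z₀ (sys.driftAttack w v x₀ z₀ s₀) t ω = WithLp.toLp 2
        ((traj sys.coupledLoop (WithLp.toLp 2 (x₀ - s₀, z₀), x₀) (noise w v ω) t).2,
          (traj sys.closedLoop (WithLp.toLp 2 (x₀ - s₀, z₀)) (noise w v ω) t).snd) := by
  induction t with
  | zero => rfl
  | succ t ih =>
    have hs : sys.state w v x₀ z₀ (sys.driftAttack w v x₀ z₀ s₀) (t + 1) ω =
      sys.attackedLoop (sys.state w v x₀ z₀ (sys.driftAttack w v x₀ z₀ s₀) t ω)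
        (w t ω, v t ω, sys.driftAttack w v x₀ z₀ s₀ t ω) := rfl
    rw [hs, ih, traj, traj]
    simp only [driftAttack, attackedLoop, input_shift, ctrl_shift, WithLp.toLp_fst, coupledLoop,
      closedLoop, fst_traj_coupledLoop, WithLp.toLp_snd]
    rfl

lemma isDriftAttack_driftAttack (s₀ : E n) :
    sys.IsDriftAttack w v x₀ z₀ s₀ (sys.driftAttack w v x₀ z₀ s₀) := by
  refine ⟨fun t ω =>
    (traj sys.coupledLoop (WithLp.toLp 2 (x₀ - s₀, z₀), x₀) (noise w v ω) t).2 -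
      (traj sys.closedLoop (WithLp.toLp 2 (x₀ - s₀, z₀)) (noise w v ω) t).fst,
    fun ω => ⟨?_, fun t => ⟨?_, ?_⟩⟩⟩
  · simp [traj]
  · simp only [state_driftAttack, driftAttack, input_shift, WithLp.toLp_fst, sub_sub_cancel]
    rw [traj, traj]
    simp only [coupledLoop, closedLoop, attackedLoop, fst_traj_coupledLoop, WithLp.toLp_fst]
    exact add_sub_add_right_eq_sub _ _ _
  · simp only [state_driftAttack, driftAttack, WithLp.toLp_fst, sub_sub_cancel]

variable {sys w v x₀ z₀}

/-- The generated attack is determined by its initial value. -/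
lemma IsDriftAttack.eq_driftAttack {s₀ : E n} {a : ℕ → Ω → E p}
    (ha : sys.IsDriftAttack w v x₀ z₀ s₀ a) : a = sys.driftAttack w v x₀ z₀ s₀ := by
  obtain ⟨s, hs⟩ := ha
  funext t ω
  obtain ⟨hs0, hs1⟩ := hs ω
  set X : LoopState n q := WithLp.toLp 2 (x₀ - s₀, z₀) with hXdef
  -- State and drift signal must be identified together: the state at time `t + 1` needs `a t`,
  -- which depends on `s t`, and `s (t + 1)` needs the state at time `t`.
  have key : ∀ t, sys.state w v x₀ z₀ a t ω = WithLp.toLp 2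
        ((traj sys.coupledLoop (X, x₀) (noise w v ω) t).2,
          (traj sys.closedLoop X (noise w v ω) t).snd) ∧
      s t ω = (traj sys.coupledLoop (X, x₀) (noise w v ω) t).2 -
        (traj sys.closedLoop X (noise w v ω) t).fst := by
    intro t
    induction t with
    | zero => exact ⟨rfl, by rw [hs0]; simp [traj, X]⟩
    | succ t ih =>
      obtain ⟨ih1, ih2⟩ := ih
      obtain ⟨h1, h2⟩ := hs1 t
      simp only [ih1, ih2, WithLp.toLp_fst, sub_sub_cancel] at h1 h2
      simp only [h2, input_shift] at h1
      have hst : sys.state w v x₀ z₀ a (t + 1) ω =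
        sys.attackedLoop (sys.state w v x₀ z₀ a t ω) (w t ω, v t ω, a t ω) := rfl
      constructor
      · rw [hst, ih1, h2]
        simp only [attackedLoop, input_shift, ctrl_shift, WithLp.toLp_fst]
        rw [traj, traj]
        simp only [coupledLoop, closedLoop, attackedLoop, fst_traj_coupledLoop, WithLp.toLp_snd]
        rfl
      · rw [h1, traj, traj]
        simp only [coupledLoop, closedLoop, attackedLoop, fst_traj_coupledLoop, WithLp.toLp_fst]
        exact (add_sub_add_right_eq_sub _ _ _).symm
  obtain ⟨h1, h2⟩ := key t
  have := (hs1 t).2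
  simp only [h1, h2, WithLp.toLp_fst, sub_sub_cancel] at this
  exact this

lemma observed_driftAttack (s₀ : E n) (t : ℕ) (ω : Ω) :
    sys.observed w v x₀ z₀ (sys.driftAttack w v x₀ z₀ s₀) t ω =
      sys.nominalData (WithLp.toLp 2 (x₀ - s₀, z₀)) t (noise w v ω) := by
  funext i
  simp only [observed, nominalData, state_driftAttack, driftAttack, received_shift, ctrl_shift]
  rfl

end Attack

end FeedbackSystem

/-! ### Divergence, stealthiness and unboundedness of the generated attack -/

namespace FeedbackSystem

/-- If the two plant states drift apart for every input and the closed loop contracts, then the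
attacked run drifts away from the run without attack. -/
lemma tendsto_norm_state_driftAttack_sub {n m p q : ℕ} {sys : FeedbackSystem n m p q} {Ω : Type*}
    {w : ℕ → Ω → E n} {v : ℕ → Ω → E p} {S : Set (E n)}
    (hIES : IncrExpStable sys.closedLoop {X | X.fst ∈ S}) {x s : E n} (z : E q) (hx : x ∈ S)
    (hxs : x - s ∈ S) (hdrift : ∀ d, DriftApart sys.inputToState x (x - s) d) (ω : Ω) :
    Tendsto (fun t => ‖(sys.state w v x z (sys.driftAttack w v x z s) t ω).fst -
      (sys.state w v x z (fun _ _ => 0) t ω).fst‖) atTop atTop := by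
  obtain ⟨κ, hκ, lam, hlam, hIES⟩ := hIES
  set X : LoopState n q := WithLp.toLp 2 (x, z)
  set X' : LoopState n q := WithLp.toLp 2 (x - s, z)
  have hbound (t : ℕ) : ‖(traj sys.closedLoop X' (noise w v ω) t).fst -
      (traj sys.closedLoop X (noise w v ω) t).fst‖ ≤ κ * ‖X' - X‖ := by
    calc _ ≤ ‖traj sys.closedLoop X' (noise w v ω) t - traj sys.closedLoop X (noise w v ω) t‖ :=
          WithLp.norm_fst_le _ (traj sys.closedLoop X' (noise w v ω) t -
            traj sys.closedLoop X (noise w v ω) t)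
      _ ≤ κ * ‖X' - X‖ * lam ^ (-(t : ℤ)) := hIES X' hxs X hx _ t
      _ ≤ κ * ‖X' - X‖ * 1 := by
          gcongr
          exact zpow_le_one_of_nonpos₀ hlam.le (by simp)
      _ = _ := mul_one _
  refine tendsto_atTop.2 fun M => ?_
  -- The input comes from the virtual loop. The threshold adds the largest possible distance between
  -- the two closed loops to `M`; the `max` with `1` makes it positive.
  obtain ⟨t', ht'⟩ := hdrift (sys.nominalInput X' (noise w v ω))
    (max 1 (M + κ * ‖X' - X‖)) (by positivity)
  filter_upwards [eventually_ge_atTop t'] with t ht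
  have h1 := (le_max_right _ _).trans (ht' t ht)
  rw [state_driftAttack, state_zero, WithLp.toLp_fst, snd_traj_coupledLoop]
  have h2 := hbound t
  rw [fst_traj_closedLoop] at h2
  have h3 := norm_sub_le_norm_sub_add_norm_sub
    (traj sys.inputToState x (sys.nominalInput X' (noise w v ω)) t)
    (traj sys.closedLoop X (noise w v ω) t).fst
    (traj sys.inputToState (x - s) (sys.nominalInput X' (noise w v ω)) t)
  rw [norm_sub_rev (traj sys.closedLoop X (noise w v ω) t).fst] at h3
  have h4 : ‖traj sys.inputToState X'.fst (sys.nominalInput X' (noise w v ω)) t -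
    (traj sys.closedLoop X (noise w v ω) t).fst‖ ≤ κ * ‖X' - X‖ := h2
  change M ≤ ‖traj sys.inputToState x (sys.nominalInput X' (noise w v ω)) t -
    (traj sys.closedLoop X (noise w v ω) t).fst‖
  change ‖traj sys.inputToState (x - s) (sys.nominalInput X' (noise w v ω)) t -
    (traj sys.closedLoop X (noise w v ω) t).fst‖ ≤ κ * ‖X' - X‖ at h4
  linarith

variable {n m p q : ℕ} {sys : FeedbackSystem n m p q} {Ω : Type*} [MeasurableSpace Ω]
  {P : Measure Ω} [IsProbabilityMeasure P]
  {Sw : Matrix (Fin n) (Fin n) ℝ} {Sv : Matrix (Fin p) (Fin p) ℝ}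
  {w : ℕ → Ω → E n} {v : ℕ → Ω → E p} {Q : Measure (ℕ → E n × E p)} [IsProbabilityMeasure Q]

lemma measurable_noise (hwm : ∀ t, Measurable (w t)) (hvm : ∀ t, Measurable (v t)) :
    Measurable (noise w v) :=
  measurable_pi_lambda _ fun i => (hwm i).prodMk (hvm i)

lemma map_noise_head_tail (hwm : ∀ t, Measurable (w t)) (hvm : ∀ t, Measurable (v t))
    (hw : ∀ t, HasLaw (w t) (multivariateGaussian 0 Sw) P)
    (hv : ∀ t, HasLaw (v t) (multivariateGaussian 0 Sv) P)
    (hwv : ∀ t, IndepFun (w t) (v t) P)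
    (hind : iIndepFun (fun t ω => (w t ω, v t ω)) P) :
    (P.map (noise w v)).map (fun d => (d 0, fun i => d (i + 1))) =
      (noiseLaw Sw Sv).prod (P.map (noise w v)) := by
  rw [Measure.map_map (by fun_prop) (measurable_noise hwm hvm)]
  refine map_head_tail (fun t => (hwm t).prodMk (hvm t)) (fun t => ?_) hind
  rw [(indepFun_iff_map_prod_eq_prod_map_map (hwm t).aemeasurable (hvm t).aemeasurable).1 (hwv t),
    (hw t).map_eq, (hv t).map_eq, noiseLaw]

/-- The law of the data in the loop started at `x'` is the image, under the data map of the loop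
started at `x`, of the law of the sheared noise. -/
lemma map_nominalData_eq_map_shear (hf : Continuous (Function.uncurry sys.f))
    (hfc : Measurable (Function.uncurry sys.fc)) (hhc : Measurable (Function.uncurry sys.hc))
    (hh : Continuous sys.h) (hQ : Q.map (fun d => (d 0, fun i => d (i + 1))) =
      (noiseLaw Sw Sv).prod Q) (x x' : E n) (z : E q) (t : ℕ) :
    Q.map (sys.nominalData (WithLp.toLp 2 (x', z)) t) =
      (((noiseLaw Sw Sv).map (shear (sys.h x' - sys.h x) (sys.inputShift x x' z))).prod Q).map
        (fun y => sys.nominalData (WithLp.toLp 2 (x, z)) t (consSeq y.1 y.2)) := by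
  have hG (x : E n) : Measurable fun y : (E n × E p) × (ℕ → E n × E p) =>
      sys.nominalData (WithLp.toLp 2 (x, z)) t (consSeq y.1 y.2) :=
    (measurable_nominalData hf hfc hhc hh _ t).comp measurable_consSeq
  have hS := measurable_shear (sys.h x' - sys.h x) (measurable_inputShift hf hfc hhc hh x x' z)
  have h1 : sys.nominalData (WithLp.toLp 2 (x', z)) t =
      (fun y : (E n × E p) × (ℕ → E n × E p) =>
        sys.nominalData (WithLp.toLp 2 (x', z)) t (consSeq y.1 y.2)) ∘
      (fun d => (d 0, fun i => d (i + 1))) := by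
    funext d; simp only [Function.comp, consSeq_head_tail]
  have h2 : (fun y : (E n × E p) × (ℕ → E n × E p) =>
        sys.nominalData (WithLp.toLp 2 (x', z)) t (consSeq y.1 y.2)) =
      (fun y => sys.nominalData (WithLp.toLp 2 (x, z)) t (consSeq y.1 y.2)) ∘
        Prod.map (shear (sys.h x' - sys.h x) (sys.inputShift x x' z)) id := by
    funext y; exact sys.nominalData_consSeq_shear x x' z t y.1 y.2
  have h3 := Measure.map_prod_map (noiseLaw Sw Sv) Q hS measurable_id
  rw [Measure.map_id] at h3
  rw [h1, ← Measure.map_map (hG x') (by fun_prop), hQ, h2,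
    ← Measure.map_map (hG x) (hS.prodMap measurable_id), ← h3]

lemma map_nominalData_eq (hf : Continuous (Function.uncurry sys.f))
    (hfc : Measurable (Function.uncurry sys.fc)) (hhc : Measurable (Function.uncurry sys.hc))
    (hh : Continuous sys.h) (hQ : Q.map (fun d => (d 0, fun i => d (i + 1))) =
      (noiseLaw Sw Sv).prod Q) (x : E n) (z : E q) (t : ℕ) :
    Q.map (sys.nominalData (WithLp.toLp 2 (x, z)) t) = ((noiseLaw Sw Sv).prod Q).map
        (fun y => sys.nominalData (WithLp.toLp 2 (x, z)) t (consSeq y.1 y.2)) := by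
  have h := map_nominalData_eq_map_shear hf hfc hhc hh hQ x x z t
  have hs : shear (sys.h x - sys.h x) (sys.inputShift x x z) = id := by
    funext d; simp [shear, inputShift]
  rwa [hs, Measure.map_id] at h

/-- Affinity of the laws of the noise with and without the shear that accounts for the change of
the initial plant state from `x` to `x - s`. -/
noncomputable def affinity (sys : FeedbackSystem n m p q) (Sw : Matrix (Fin n) (Fin n) ℝ)
    (Sv : Matrix (Fin p) (Fin p) ℝ) (x : E n) (z : E q) (s : E n) : ℝ≥0∞ :=
  ∫⁻ d, min 1 (ENNReal.ofReal (Real.exp (shearLogDensity Sw Sv (sys.h (x - s) - sys.h x)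
    (sys.inputShift x (x - s) z) d))) ∂noiseLaw Sw Sv

lemma tendsto_affinity (hf : Continuous (Function.uncurry sys.f))
    (hfc : Measurable (Function.uncurry sys.fc)) (hhc : Measurable (Function.uncurry sys.hc))
    (hh : Continuous sys.h) (x : E n) (z : E q) :
    Tendsto (affinity sys Sw Sv x z) (𝓝 0) (𝓝 1) := by
  refine tendsto_lintegral_min_shearLogDensity
    (fun s => measurable_inputShift hf hfc hhc hh x (x - s) z) ?_ fun y => ?_
  · have : Continuous fun s => sys.h (x - s) - sys.h x := by fun_prop
    simpa using this.tendsto 0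
  · have h1 : Continuous fun s => sys.inputShift x (x - s) z y :=
      (hf.comp (f := fun s => (x - s, sys.input (WithLp.toLp 2 (x, z)) y 0))
        (by fun_prop)).sub continuous_const
    simpa [inputShift] using h1.tendsto 0

/-- A detector reading the data is a test between sheared and original noise, via the common map
`G`. The affinity involves only the noise at time `0`, hence not `t`. -/
lemma affinity_le_errorSum (hf : Continuous (Function.uncurry sys.f))
    (hfc : Measurable (Function.uncurry sys.fc)) (hhc : Measurable (Function.uncurry sys.hc))
    (hh : Continuous sys.h) (hSw : Sw.PosDef) (hSv : Sv.PosDef)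
    (hwm : ∀ t, Measurable (w t)) (hvm : ∀ t, Measurable (v t))
    (hQ : (P.map (noise w v)).map (fun d => (d 0, fun i => d (i + 1))) =
      (noiseLaw Sw Sv).prod (P.map (noise w v)))
    (x : E n) (z : E q) (s : E n) (t : ℕ) {D : (Fin (t + 1) → E p × E q) → Bool}
    (hD : Measurable D) :
    affinity sys Sw Sv x z s ≤
      ENNReal.ofReal (sys.errorSum w v x z P (sys.driftAttack w v x z s) t D) := by
  have hN := measurable_noise hwm hvm
  have : IsProbabilityMeasure (P.map (noise w v)) := Measure.isProbabilityMeasure_map hN.aemeasurable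
  have hG : Measurable fun y : (E n × E p) × (ℕ → E n × E p) =>
      sys.nominalData (WithLp.toLp 2 (x, z)) t (consSeq y.1 y.2) :=
    (measurable_nominalData hf hfc hhc hh _ t).comp measurable_consSeq
  set G := fun y : (E n × E p) × (ℕ → E n × E p) =>
      sys.nominalData (WithLp.toLp 2 (x, z)) t (consSeq y.1 y.2) with hGdef
  have hη := measurable_inputShift hf hfc hhc hh x (x - s) z
  have hρ := (measurable_shearLogDensity (Sw := Sw) (Sv := Sv)
    (sys.h (x - s) - sys.h x) hη).exp.ennreal_ofReal
  have hA0 : MeasurableSet {Y | D Y = false} := hD (measurableSet_singleton _)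
  have hA1 : MeasurableSet {Y | D Y = true} := hD (measurableSet_singleton _)
  have hX (x : E n) := measurable_nominalData hf hfc hhc hh (WithLp.toLp 2 (x, z)) t
  have e0 : P {ω | D (sys.observed w v x z (sys.driftAttack w v x z s) t ω) = false} =
      (((noiseLaw Sw Sv).map (shear (sys.h (x - s) - sys.h x) (sys.inputShift x (x - s) z))).prod
        (P.map (noise w v))) (G ⁻¹' {Y | D Y = false}) := by
    rw [← Measure.map_apply hG hA0, ← map_nominalData_eq_map_shear hf hfc hhc hh hQ,
      Measure.map_map (hX _) hN, Measure.map_apply ((hX _).comp hN) hA0]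
    simp only [observed_driftAttack]
    rfl
  have e1 : P {ω | D (sys.observed w v x z (fun _ _ => 0) t ω) = true} =
      ((noiseLaw Sw Sv).prod (P.map (noise w v))) (G ⁻¹' {Y | D Y = false})ᶜ := by
    have hc : (G ⁻¹' {Y | D Y = false})ᶜ = G ⁻¹' {Y | D Y = true} := by ext y; simp
    rw [hc, ← Measure.map_apply hG hA1, ← map_nominalData_eq hf hfc hhc hh hQ,
      Measure.map_map (hX _) hN, Measure.map_apply ((hX _).comp hN) hA1]
    simp only [observed_zero]
    rfl
  have hfst : affinity sys Sw Sv x z s = ∫⁻ y, min 1 (ENNReal.ofReal (Real.exp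
      (shearLogDensity Sw Sv (sys.h (x - s) - sys.h x) (sys.inputShift x (x - s) z) y.1)))
        ∂(noiseLaw Sw Sv).prod (P.map (noise w v)) := by
    have h := lintegral_map (μ := (noiseLaw Sw Sv).prod (P.map (noise w v)))
      (measurable_const.min hρ : Measurable fun d => min 1 (ENNReal.ofReal (Real.exp
      (shearLogDensity Sw Sv (sys.h (x - s) - sys.h x) (sys.inputShift x (x - s) z) d))))
      measurable_fst
    rw [← h, Measure.map_fst_prod, measure_univ, one_smul, affinity]
  rw [errorSum, measureReal_def, measureReal_def,
    ENNReal.ofReal_add ENNReal.toReal_nonneg ENNReal.toReal_nonneg,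
    ENNReal.ofReal_toReal (measure_ne_top _ _), ENNReal.ofReal_toReal (measure_ne_top _ _), e0, e1,
    noiseLaw_map_shear hSw hSv _ hη, prod_withDensity_left hρ, hfst]
  exact lintegral_min_le_withDensity_add_compl (hρ.comp measurable_fst) (hG hA0)

/-- Generated attacks with small initial value are stealthy. -/
lemma eventually_isStealthy_driftAttack (hf : Continuous (Function.uncurry sys.f))
    (hfc : Measurable (Function.uncurry sys.fc)) (hhc : Measurable (Function.uncurry sys.hc))
    (hh : Continuous sys.h) (hSw : Sw.PosDef) (hSv : Sv.PosDef)
    (hwm : ∀ t, Measurable (w t)) (hvm : ∀ t, Measurable (v t))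
    (hQ : (P.map (noise w v)).map (fun d => (d 0, fun i => d (i + 1))) =
      (noiseLaw Sw Sv).prod (P.map (noise w v)))
    (x : E n) (z : E q) {ε : ℝ} (hε : 0 < ε) :
    ∀ᶠ s in 𝓝 (0 : E n), sys.IsStealthy w v x z P ε (sys.driftAttack w v x z s) := by
  have hlt : ENNReal.ofReal (1 - ε) < 1 := by
    rw [ENNReal.ofReal_lt_one]; linarith
  filter_upwards [(tendsto_affinity (Sw := Sw) (Sv := Sv) hf hfc hhc hh x z).eventually
    (lt_mem_nhds hlt)] with s hs
  rintro t ⟨D, hD, hlt'⟩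
  have h1 := hs.trans_le (affinity_le_errorSum hf hfc hhc hh hSw hSv hwm hvm hQ x z s t hD)
  exact absurd (ENNReal.ofReal_le_ofReal hlt'.le) (not_le.2 h1)

lemma measurable_driftAttack (hf : Continuous (Function.uncurry sys.f))
    (hfc : Measurable (Function.uncurry sys.fc)) (hhc : Measurable (Function.uncurry sys.hc))
    (hh : Continuous sys.h) (hwm : ∀ t, Measurable (w t)) (hvm : ∀ t, Measurable (v t))
    (x : E n) (z : E q) (s : E n) (t : ℕ) : Measurable (sys.driftAttack w v x z s t) := by
  have hN := measurable_noise hwm hvm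
  have h1 : Measurable fun ω =>
      (traj sys.closedLoop (WithLp.toLp 2 (x - s, z)) (noise w v ω) t).fst :=
    measurable_fst.comp ((WithLp.measurable_ofLp 2 _).comp
      ((measurable_traj (measurable_closedLoop hf hfc hhc hh) t).comp
        (measurable_const.prodMk hN)))
  have h2 : Measurable fun ω =>
      (traj sys.coupledLoop (WithLp.toLp 2 (x - s, z), x) (noise w v ω) t).2 :=
    measurable_snd.comp ((measurable_traj (measurable_coupledLoop hf hfc hhc hh) t).comp
      (measurable_const.prodMk hN))
  exact (hh.measurable.comp h1).sub (hh.measurable.comp h2)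

/-- Under a generated attack the plant state almost surely leaves every ball. -/
lemma ae_exists_le_norm_driftAttack [Nonempty (Fin n)] (hf : Continuous (Function.uncurry sys.f))
    (hfc : Measurable (Function.uncurry sys.fc)) (hhc : Measurable (Function.uncurry sys.hc))
    (hh : Continuous sys.h) (hSw : Sw.PosDef)
    (hwm : ∀ t, Measurable (w t)) (hvm : ∀ t, Measurable (v t))
    (hQ : (P.map (noise w v)).map (fun d => (d 0, fun i => d (i + 1))) =
      (noiseLaw Sw Sv).prod (P.map (noise w v)))
    (x : E n) (z : E q) (s : E n) (α : ℝ) :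
    ∀ᵐ ω ∂P, ∃ t, α ≤ ‖(sys.state w v x z (sys.driftAttack w v x z s) t ω).fst‖ := by
  have hN := measurable_noise hwm hvm
  have : IsProbabilityMeasure (P.map (noise w v)) := Measure.isProbabilityMeasure_map hN.aemeasurable
  obtain ⟨β, hβ, hball⟩ := exists_bound_multivariateGaussian_ball hSw α
  have hF := measurable_coupledLoop hf hfc hhc hh
  have hK : MeasurableSet {Z : LoopState n q × E n | ‖Z.2‖ < α} :=
    measurableSet_lt measurable_snd.norm measurable_const
  have hstep (ξ : LoopState n q × E n) :
      noiseLaw Sw Sv {d | sys.coupledLoop ξ d ∈ {Z : LoopState n q × E n | ‖Z.2‖ < α}} ≤ β := by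
    have hm : MeasurableSet
        {d | sys.coupledLoop ξ d ∈ {Z : LoopState n q × E n | ‖Z.2‖ < α}} :=
      (hF.comp measurable_prodMk_left) hK
    -- For fixed measurement noise the input is fixed, and the next state of the copy is a constant
    -- plus the Gaussian `w`.
    rw [noiseLaw, Measure.prod_apply_symm hm]
    calc _ ≤ ∫⁻ _, β ∂multivariateGaussian 0 Sv :=
          lintegral_mono fun y => hball (sys.f ξ.2 (sys.input ξ.1 y 0))
      _ = β := by simp
  have h0 := measure_forall_traj_mem_eq_zero hF hK hQ hβ hstep (WithLp.toLp 2 (x - s, z), x)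
  have hae : ∀ᵐ d ∂P.map (noise w v), ¬ ∀ t, traj sys.coupledLoop (WithLp.toLp 2 (x - s, z), x)
      d (t + 1) ∈ {Z : LoopState n q × E n | ‖Z.2‖ < α} := by
    rw [ae_iff]; simpa only [not_not] using h0
  filter_upwards [ae_of_ae_map hN.aemeasurable hae] with ω hω
  obtain ⟨t, ht⟩ := not_forall.1 hω
  refine ⟨t + 1, ?_⟩
  rw [state_driftAttack, WithLp.toLp_fst]
  exact not_lt.1 ht

lemma klDiv_observed_driftAttack_le (hf : Continuous (Function.uncurry sys.f))
    (hfc : Measurable (Function.uncurry sys.fc)) (hhc : Measurable (Function.uncurry sys.hc))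
    (hh : Continuous sys.h) (hSw : Sw.PosDef) (hSv : Sv.PosDef)
    (hwm : ∀ t, Measurable (w t)) (hvm : ∀ t, Measurable (v t))
    (hQ : (P.map (noise w v)).map (fun d => (d 0, fun i => d (i + 1))) =
      (noiseLaw Sw Sv).prod (P.map (noise w v)))
    (x : E n) (z : E q) (s : E n) (t : ℕ) {M N : ℝ} (hM : ‖sys.h (x - s) - sys.h x‖ ≤ M)
    (hN : ∀ u, ‖sys.f (x - s) u - sys.f x u‖ ≤ N) :
    InformationTheory.klDiv (P.map (sys.observed w v x z (sys.driftAttack w v x z s) t))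
      (P.map (sys.observed w v x z (fun _ _ => 0) t)) ≤
      ENNReal.ofReal (‖Matrix.toEuclideanCLM (𝕜 := ℝ) Sv⁻¹‖ * M ^ 2 / 2 +
        ‖Matrix.toEuclideanCLM (𝕜 := ℝ) Sw⁻¹‖ * N ^ 2 / 2) := by
  have hNm := measurable_noise hwm hvm
  have : IsProbabilityMeasure (P.map (noise w v)) := Measure.isProbabilityMeasure_map hNm.aemeasurable
  have hη := measurable_inputShift hf hfc hhc hh x (x - s) z
  have hS := measurable_shear (sys.h (x - s) - sys.h x) hη
  have : IsProbabilityMeasure ((noiseLaw Sw Sv).map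
      (shear (sys.h (x - s) - sys.h x) (sys.inputShift x (x - s) z))) :=
    Measure.isProbabilityMeasure_map hS.aemeasurable
  have hX (x : E n) := measurable_nominalData hf hfc hhc hh (WithLp.toLp 2 (x, z)) t
  have e0 : sys.observed w v x z (sys.driftAttack w v x z s) t =
      sys.nominalData (WithLp.toLp 2 (x - s, z)) t ∘ noise w v :=
    funext fun ω => observed_driftAttack s t ω
  have e1 : sys.observed w v x z (fun _ _ => 0) t =
      sys.nominalData (WithLp.toLp 2 (x, z)) t ∘ noise w v :=
    funext fun ω => sys.observed_zero w v x z t ω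
  rw [e0, e1, ← Measure.map_map (hX _) hNm, ← Measure.map_map (hX _) hNm,
    map_nominalData_eq_map_shear hf hfc hhc hh hQ x (x - s) z t,
    map_nominalData_eq hf hfc hhc hh hQ x z t]
  -- Data processing: both laws are images under the same map.
  refine (InformationTheory.klDiv_map_le _ _
    ((measurable_nominalData hf hfc hhc hh _ t).comp measurable_consSeq)).trans ?_
  rw [klDiv_prod_right]
  exact klDiv_map_shear_le hSw hSv hη hM fun y => hN _

end FeedbackSystem

lemma not_driftApart_self {X D : Type*} [NormedAddCommGroup X] (F : X → D → X) (ξ : X)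
    (d : ℕ → D) : ¬ DriftApart F ξ ξ d := fun h => by
  obtain ⟨t, ht⟩ := h 1 one_pos
  have := ht t le_rfl
  rw [sub_self, norm_zero] at this
  linarith

end StealthyAttack

/-! ### Assembly of the four claims -/

theorem theorem1 {Ω : Type*} [MeasurableSpace Ω] (P : Measure Ω) [IsProbabilityMeasure P]
    {n m p q : ℕ} (sys : FeedbackSystem n m p q)
    (hf : Continuous (Function.uncurry sys.f))
    (hfc : Measurable (Function.uncurry sys.fc)) (hhc : Measurable (Function.uncurry sys.hc))
    (Lh : ℝ≥0) (hh : LipschitzWith Lh sys.h)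
    (Sw : Matrix (Fin n) (Fin n) ℝ) (hSw : Sw.PosDef)
    (Sv : Matrix (Fin p) (Fin p) ℝ) (hSv : Sv.PosDef)
    (w : ℕ → Ω → E n) (v : ℕ → Ω → E p)
    (hwm : ∀ t, Measurable (w t)) (hvm : ∀ t, Measurable (v t))
    (hw : ∀ t, HasLaw (w t) (multivariateGaussian 0 Sw) P)
    (hv : ∀ t, HasLaw (v t) (multivariateGaussian 0 Sv) P)
    (hwv : ∀ t, IndepFun (w t) (v t) P)
    (hind : iIndepFun (fun t ω => (w t ω, v t ω)) P)
    (RS : ℝ) (hRS : 0 < RS)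
    (hIES : IncrExpStable sys.closedLoop {X | X.fst ∈ Metric.closedBall (0 : E n) RS})
    (hIU : IncrUnstable sys.inputToState (Metric.closedBall (0 : E n) RS)) :
    -- attackability for all accuracies and all radii
    (∀ x₀ ∈ Metric.closedBall (0 : E n) RS, ∀ z₀ : E q, ∀ ε : ℝ, 0 < ε → ∀ α : ℝ,
      sys.IsAttackable w v x₀ z₀ P ε α) ∧
    -- every sufficiently small nonzero initial value gives such an attack, for all radii at once
    (∀ x₀ ∈ Metric.closedBall (0 : E n) RS, ∀ z₀ : E q, ∀ ε : ℝ, 0 < ε →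
      ∃ ρ : ℝ, 0 < ρ ∧ ∀ s₀ : E n, s₀ ≠ 0 → ‖s₀‖ < ρ →
        ∃ a : ℕ → Ω → E p, sys.IsDriftAttack w v x₀ z₀ s₀ a ∧
          ∀ α : ℝ, sys.IsSuccessful w v x₀ z₀ P ε α a) ∧
    -- divergence from the run without attack, for every noise realization
    (IncrUnstableUnif sys.inputToState (Metric.closedBall (0 : E n) RS) →
      ∀ x₀ ∈ Metric.closedBall (0 : E n) RS, ∀ z₀ : E q, ∀ ε : ℝ, 0 < ε →
        ∃ s₀ : E n, s₀ ≠ 0 ∧ ‖s₀‖ < ε ∧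
          ∃ a : ℕ → Ω → E p, sys.IsDriftAttack w v x₀ z₀ s₀ a ∧
            (∀ α : ℝ, sys.IsSuccessful w v x₀ z₀ P ε α a) ∧
            ∀ ω : Ω,
              Tendsto (fun t => ‖(sys.state w v x₀ z₀ a t ω).fst -
                (sys.state w v x₀ z₀ (fun _ _ => 0) t ω).fst‖) atTop atTop ∧
              ∀ α : ℝ, ∃ t' : ℕ, ∀ t : ℕ, t' ≤ t →
                (sys.state w v x₀ z₀ (fun _ _ => 0) t ω).fst ∈ Metric.closedBall (0 : E n) RS →
                α ≤ ‖(sys.state w v x₀ z₀ a t ω).fst‖) ∧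
    -- uniform bound on the divergence of the observed data
    (∀ Lf : ℝ≥0, (∀ u : E m, LipschitzOnWith Lf (fun x => sys.f x u)
        (Metric.closedBall (0 : E n) RS)) →
      ∃ C : ℝ≥0, ∀ x₀ ∈ Metric.closedBall (0 : E n) RS, ∀ z₀ : E q, ∀ s₀ : E n,
        x₀ - s₀ ∈ Metric.closedBall (0 : E n) RS →
        ∀ a : ℕ → Ω → E p, sys.IsDriftAttack w v x₀ z₀ s₀ a → ∀ t : ℕ,
          InformationTheory.klDiv (P.map (sys.observed w v x₀ z₀ a t))
              (P.map (sys.observed w v x₀ z₀ (fun _ _ => 0) t)) ≤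
            ENNReal.ofReal (C * ‖s₀‖ ^ 2)) := by
    classical
  have hhc' := hh.continuous
  have hQ := FeedbackSystem.map_noise_head_tail hwm hvm hw hv hwv hind
  -- In dimension `0` there is only one state, which cannot drift apart from itself.
  have hne : Nonempty (Fin n) := by
    by_contra hcon
    rw [not_nonempty_iff] at hcon
    obtain ⟨ξ, hξ⟩ := hIU 0 (Metric.mem_closedBall_self hRS.le) fun _ => (0, 0)
    rw [Subsingleton.elim ξ 0] at hξ
    exact not_driftApart_self _ _ _ hξ
  -- Only stealthiness restricts `s₀`; every ball is left whatever `s₀` is, so one `ρ` serves all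
  -- `α`.
  have hsmall : ∀ x₀ : E n, ∀ z₀ : E q, ∀ ε : ℝ, 0 < ε → ∃ ρ : ℝ, 0 < ρ ∧ ∀ s₀ : E n, ‖s₀‖ < ρ →
      ∀ α : ℝ, sys.IsSuccessful w v x₀ z₀ P ε α (sys.driftAttack w v x₀ z₀ s₀) := by
    intro x₀ z₀ ε hε
    obtain ⟨ρ, hρ, hball⟩ := Metric.eventually_nhds_iff.1
      (FeedbackSystem.eventually_isStealthy_driftAttack hf hfc hhc hhc' hSw hSv hwm hvm hQ x₀ z₀ hε)
    exact ⟨ρ, hρ, fun s₀ hs₀ α =>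
      ⟨FeedbackSystem.measurable_driftAttack hf hfc hhc hhc' hwm hvm x₀ z₀ s₀,
        FeedbackSystem.ae_exists_le_norm_driftAttack hf hfc hhc hhc' hSw hwm hvm hQ x₀ z₀ s₀ α,
        hball (by simpa using hs₀)⟩⟩
  refine ⟨fun x₀ _ z₀ ε hε α => ?_, fun x₀ _ z₀ ε hε => ?_, fun hU x₀ hx₀ z₀ ε hε => ?_,
    fun Lf hLf => ?_⟩
  · obtain ⟨ρ, hρ, h⟩ := hsmall x₀ z₀ ε hε
    obtain ⟨s₀, hs₀⟩ := exists_norm_eq (E n) (half_pos hρ).le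
    exact ⟨_, h s₀ (by linarith) α⟩
  · obtain ⟨ρ, hρ, h⟩ := hsmall x₀ z₀ ε hε
    exact ⟨ρ, hρ, fun s₀ _ hs₀ =>
      ⟨_, sys.isDriftAttack_driftAttack w v x₀ z₀ s₀, h s₀ hs₀⟩⟩
  · obtain ⟨ρ, hρ, h⟩ := hsmall x₀ z₀ ε hε
    obtain ⟨ξ, hξ, hdist, hdrift⟩ := hU x₀ hx₀ (min ε ρ) (lt_min hε hρ)
    have hξs : x₀ - (x₀ - ξ) = ξ := sub_sub_cancel _ _
    refine ⟨x₀ - ξ, fun h0 => ?_, hdist.trans_le (min_le_left _ _),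
      sys.driftAttack w v x₀ z₀ (x₀ - ξ), sys.isDriftAttack_driftAttack w v x₀ z₀ _,
      h _ (hdist.trans_le (min_le_right _ _)), fun ω => ?_⟩
    · rw [← sub_eq_zero.1 h0] at hdrift
      exact not_driftApart_self _ _ _ (hdrift fun _ => (0, 0))
    · have ht := FeedbackSystem.tendsto_norm_state_driftAttack_sub (w := w) (v := v) hIES z₀ hx₀
        (hξs.symm ▸ hξ) (hξs.symm ▸ hdrift) ω
      refine ⟨ht, fun α => ?_⟩
      -- The summand `RS` absorbs the norm of the state without attack in the triangle inequality.
      obtain ⟨t', ht'⟩ := eventually_atTop.1 (ht.eventually_ge_atTop (α + RS))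
      refine ⟨t', fun t htt hball => ?_⟩
      have h1 := ht' t htt
      have h2 := norm_sub_le (sys.state w v x₀ z₀ (sys.driftAttack w v x₀ z₀ (x₀ - ξ)) t ω).fst
        (sys.state w v x₀ z₀ (fun _ _ => 0) t ω).fst
      rw [mem_closedBall_zero_iff] at hball
      linarith
  · set Bv := Matrix.toEuclideanCLM (𝕜 := ℝ) Sv⁻¹
    set Bw := Matrix.toEuclideanCLM (𝕜 := ℝ) Sw⁻¹
    -- The two noise translations have norm at most `Lh * ‖s₀‖` and `Lf * ‖s₀‖`; each costs half the
    -- norm of its inverse covariance times the square.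
    refine ⟨‖Bv‖₊ * Lh ^ 2 / 2 + ‖Bw‖₊ * Lf ^ 2 / 2, fun x₀ hx₀ z₀ s₀ hs₀ a ha t => ?_⟩
    rw [ha.eq_driftAttack]
    have hM : ‖sys.h (x₀ - s₀) - sys.h x₀‖ ≤ Lh * ‖s₀‖ := by
      simpa using hh.norm_sub_le (x₀ - s₀) x₀
    have hN (u : E m) : ‖sys.f (x₀ - s₀) u - sys.f x₀ u‖ ≤ Lf * ‖s₀‖ := by
      simpa using (hLf u).norm_sub_le hs₀ hx₀
    refine (FeedbackSystem.klDiv_observed_driftAttack_le hf hfc hhc hhc' hSw hSv hwm hvm hQ x₀ z₀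
      s₀ t hM hN).trans (ENNReal.ofReal_le_ofReal (le_of_eq ?_))
    push_cast
    ring
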